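/- Write $(a;q)_n=\prod_{k=0}^{n-1}(1-aq^k)$, $(a;q)_\infty=\prod_{k\ge 0}(1-aq^k)$ and $(a_1,a_2,a_3;q)_\infty=(a_1;q)_\infty(a_2;q)_\infty(a_3;q)_\infty$. For every complex $q$ with $|q|<1$ the following eight identities hold (the triple sums converge absolutely, and all exponents are nonnegative integers). Example 1: $$\sum_{i,j,k\ge 0}\frac{q^{\frac12 i^2+j^2+4k^2+ij+2jk+\frac12 i+j}}{(q;q)_i(q;q)_j(q^2;q^2)_k}=\frac{(q^8,q^{12},q^{20};q^{20})_\infty}{(q;q)_\infty},$$ $$\sum_{i,j,k\ge 0}\frac{q^{\frac12 i^2+j^2+4k^2+ij+2jk+\frac12 i+j+4k}}{(q;q)_i(q;q)_j(q^2;q^2)_k}=\frac{(q^4,q^{16},q^{20};q^{20})_\infty}{(q;q)_\infty}.$$ Example 6: $$\sum_{i,j,k\ge 0}\frac{q^{\frac12 i^2+\frac52 j^2+8k^2+ij+2ik+8jk+\frac12 i-\frac12 j}}{(q;q)_i(q;q)_j(q^2;q^2)_k}=\frac{(q^4,q^6,q^{10};q^{10})_\infty}{(q;q)_\infty},$$ $$\sum_{i,j,k\ge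 0}\frac{q^{\frac12 i^2+\frac52 j^2+8k^2+ij+2ik+8jk+\frac12 i+\frac32 j+4k}}{(q;q)_i(q;q)_j(q^2;q^2)_k}=\frac{(q^2,q^8,q^{10};q^{10})_\infty}{(q;q)_\infty}.$$ Example 7: $$\sum_{i,j,k\ge 0}\frac{q^{\frac12 i^2+4j^2+k^2+ij+2jk+\frac12 i+k}}{(q;q)_i(q;q)_j(q^2;q^2)_k}=\frac{(q^8,q^{12},q^{20};q^{20})_\infty}{(q;q)_\infty},$$ $$\sum_{i,j,k\ge 0}\frac{q^{\frac12 i^2+4j^2+k^2+ij+2jk+\frac12 i+4j+k}}{(q;q)_i(q;q)_j(q^2;q^2)_k}=\frac{(q^4,q^{16},q^{20};q^{20})_\infty}{(q;q)_\infty}.$$ Example 10: $$\sum_{i,j,k\ge 0}\frac{q^{i^2+2j^2+2k^2+ij+2ik+2jk+k}}{(q;q)_i(q;q)_j(q^2;q^2)_k}=\frac{(q^4,q^6,q^{10};q^{10})_\infty}{(q;q)_\infty},$$ $$\sum_{i,j,k\ge 0}\frac{q^{i^2+2j^2+2k^2+ij+2ik+2jk+2j+k}}{(q;q)_i(q;q)_j(q^2;q^2)_k}=\frac{(q^2,q^8,q^{10};q^{10})_\infty}{(q;q)_\infty}.$$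 Moreover, for $d=(1,1,2)$, $D=\mathrm{diag}(1,1,2)$ and each of the eight pairs $(A,b)$ $$A=\begin{pmatrix}1&1&0\\1&2&1\\0&2&4\end{pmatrix},\ b\in\{(\tfrac12,1,0)^{\mathrm T},(\tfrac12,1,4)^{\mathrm T}\};\qquad A=\begin{pmatrix}1&1&1\\1&5&4\\2&8&8\end{pmatrix},\ b\in\{(\tfrac12,-\tfrac12,0)^{\mathrm T},(\tfrac12,\tfrac32,4)^{\mathrm T}\};$$ $$A=\begin{pmatrix}1&1&0\\1&8&1\\0&2&1\end{pmatrix},\ b\in\{(\tfrac12,0,1)^{\mathrm T},(\tfrac12,4,1)^{\mathrm T}\};\qquad A=\begin{pmatrix}2&1&1\\1&4&1\\2&2&2\end{pmatrix},\ b\in\{(0,0,1)^{\mathrm T},(0,2,1)^{\mathrm T}\},$$ the matrix $AD$ is symmetric positive definite and there is $c\in\mathbb Q$ such that the generalized Nahm sum $$\widetilde f_{A,b,c,d}(q)=\sum_{n\in\mathbb Z_{\ge 0}^3}\frac{q^{\frac12 n^{\mathrm T}ADn+n^{\mathrm T}b+c}}{(q;q)_{n_1}(q;q)_{n_2}(q^2;q^2)_{n_3}},\qquad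 q^s=e^{2\pi i s\tau}\ (s\in\mathbb Q),$$ is a modular function of $\tau$: it is holomorphic on the upper half plane, invariant under some subgroup of finite index in $\mathrm{SL}_2(\mathbb Z)$, and has at most a pole at every cusp. -/

import Mathlib

open scoped UpperHalfPlane Manifold MatrixGroups

noncomputable section

/-- The finite `q`-Pochhammer symbol `(a; q)_n = ∏_{k < n} (1 - a q^k)`. -/
def qPoch (a q : ℂ) (n : ℕ) : ℂ := ∏ k ∈ Finset.range n, (1 - a * q ^ k)

/-- The infinite `q`-Pochhammer symbol `(a; q)_∞ = ∏_{k ≥ 0} (1 - a q^k)`;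
the product converges absolutely when `‖q‖ < 1`. -/
def qPochInf (a q : ℂ) : ℂ := ∏' k : ℕ, (1 - a * q ^ k)

/-- The compressed symbol `(a₁, a₂, a₃; q)_∞ = (a₁; q)_∞ (a₂; q)_∞ (a₃; q)_∞`. -/
def qPochInf₃ (a₁ a₂ a₃ q : ℂ) : ℂ := qPochInf a₁ q * qPochInf a₂ q * qPochInf a₃ q

/-- The exponent `½ nᵀ A D n + nᵀ b + c` of a generalized Nahm sum, where `D = diag(d₁, …, d_r)`. -/
def nahmExponent {r : ℕ} (A : Matrix (Fin r) (Fin r) ℚ) (b : Fin r → ℚ) (c : ℚ) (d : Fin r → ℕ)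
    (n : Fin r → ℕ) : ℚ :=
  1 / 2 * ((fun i => (n i : ℚ)) ⬝ᵥ
      Matrix.mulVec (A * Matrix.diagonal (fun i => (d i : ℚ))) (fun i => (n i : ℚ)))
    + (fun i => (n i : ℚ)) ⬝ᵥ b + c

/-- The generalized Nahm sum
`∑_{n ∈ ℕ^r} q^{½ nᵀ A D n + nᵀ b + c} / ((q^{d₁}; q^{d₁})_{n₁} ⋯ (q^{d_r}; q^{d_r})_{n_r})`
as a function of `τ` in the upper half plane, where `q^s = exp(2πi s τ)` for rational `s`. -/
def nahmSum {r : ℕ} (A : Matrix (Fin r) (Fin r) ℚ) (b : Fin r → ℚ) (c : ℚ) (d : Fin r → ℕ)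
    (τ : ℍ) : ℂ :=
  ∑' n : Fin r → ℕ,
    Complex.exp (2 * Real.pi * Complex.I * (nahmExponent A b c d n : ℂ) * (τ : ℂ)) /
      ∏ i, qPoch (Complex.exp (2 * Real.pi * Complex.I * (d i : ℂ) * (τ : ℂ)))
        (Complex.exp (2 * Real.pi * Complex.I * (d i : ℂ) * (τ : ℂ))) (n i)

/-- A modular function (of weight `0`) for some subgroup of finite index in `SL(2, ℤ)`:
holomorphic on the upper half plane, invariant under the subgroup, and with at most a pole at
every cusp. -/
def IsModularFunction (f : ℍ → ℂ) : Prop :=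
  MDifferentiable 𝓘(ℂ) 𝓘(ℂ) f ∧
  (∃ Γ : Subgroup SL(2, ℤ), Γ.FiniteIndex ∧ ∀ γ ∈ Γ, ∀ τ : ℍ, f (γ • τ) = f τ) ∧
  ∀ γ : SL(2, ℤ), ∃ m : ℕ, UpperHalfPlane.IsBoundedAtImInfty
    (fun τ : ℍ => Complex.exp (2 * Real.pi * Complex.I * (m : ℂ) * (τ : ℂ)) * f (γ • τ))

/-- `(A, b, c, d)` is a modular quadruple: the `d i` are positive, `A D` is symmetric positive
definite, and the associated generalized Nahm sum is a modular function. -/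
def IsModularQuadruple {r : ℕ} (A : Matrix (Fin r) (Fin r) ℚ) (b : Fin r → ℚ) (c : ℚ)
    (d : Fin r → ℕ) : Prop :=
  (∀ i, 0 < d i) ∧
  ((A * Matrix.diagonal (fun i => (d i : ℚ))).map (fun x : ℚ => (x : ℝ))).PosDef ∧
  IsModularFunction (nahmSum A b c d)

/-- The identity of index `(1, 1, 2)`
`∑_{i,j,k ≥ 0} q^{E(i,j,k)} / ((q; q)_i (q; q)_j (q²; q²)_k) = P`, with absolute convergence of the
triple sum. It is only used for exponents `E` that take values in the nonnegative integers, for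
which the complex power is the ordinary power. -/
def HasIndex112Sum (q : ℂ) (E : ℂ → ℂ → ℂ → ℂ) (P : ℂ) : Prop :=
  HasSum (fun n : ℕ × ℕ × ℕ =>
    q ^ (E n.1 n.2.1 n.2.2) / (qPoch q q n.1 * qPoch q q n.2.1 * qPoch (q ^ 2) (q ^ 2) n.2.2)) P

end

noncomputable section

open Filter Topology

/-! ### Basic properties of `q`-Pochhammer symbols -/

/-! All eight sums collapse to a Rogers–Ramanujan sum, and the resulting product is a theta function
over `η`.

Collapse. Euler's identity gives `∑_i q^{i(i-1)/2 + i + ij}/(q;q)_i = (-q;q)_∞/(-q;q)_j`. Since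
`(q;q)_j (-q;q)_j = (q²;q²)_j`, such a summation turns base `q` into base `q²` for the variable left
over. In Examples 1 and 7 this is done twice and ends in base `q⁴`. In Examples 6 and 10, apart from
one factor `q^{j(j-1)/2}` or `q^{i(i-1)/2}`, the exponent sees two of the variables only through `j
+ 2k`, respectively `i + 2k`. The identity `(-x;q)_∞/(x²;q²)_∞ = 1/(x;q)_∞` merges these two
variables into one (`hasSum_convolution`), and a single Euler step then ends in base `q²`. Each time
`(-q;q)_∞/(q²;q²)_∞ = 1/(q;q)_∞` restores the stated denominator.

Rogers–Ramanujan. Finite pentagonal identities expand `1/(q;q)_s` over `1/((q;q)_{s-m}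
(q;q)_{s+m+e})`, a Bailey pair. Summing against `q^{s² + es}` with Cauchy's identity
(`hasSum_of_sum_weight`) leaves a theta series, which the Jacobi triple product evaluates.

Modularity. With the right `c` the Nahm sum is `θ(Nτ)/η(τ)`, where `θ` has rational characteristics.
A suitable power of `θ` is permuted by `S` and `T`, up to the automorphy factor, within a finite
family of characteristics. The factor is cancelled by a power of `Δ = η²⁴`, and `N` is absorbed by
finitely many upper triangular matrices of determinant `N`. So a power of the quotient has finitely
many conjugates. As the quotient never vanishes and the upper half plane is connected, so does the
quotient itself, and its stabilizer has finite index (`exists_finiteIndex_of_finite_pow`). The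
growth at each cusp is read off from the same conjugates. -/

@[simp] lemma qPoch_zero (a q : ℂ) : qPoch a q 0 = 1 := by simp [qPoch]

lemma qPoch_succ (a q : ℂ) (n : ℕ) : qPoch a q (n + 1) = qPoch a q n * (1 - a * q ^ n) := by
  simp [qPoch, Finset.prod_range_succ]

lemma one_sub_mul_pow_ne_zero {a q : ℂ} (ha : ‖a‖ < 1) (hq : ‖q‖ < 1) (k : ℕ) :
    1 - a * q ^ k ≠ 0 := by
  intro h
  have h1 : a * q ^ k = 1 := (sub_eq_zero.1 h).symm
  have h2 : ‖a‖ * ‖q‖ ^ k = 1 := by rw [← norm_pow, ← norm_mul, h1, norm_one]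
  have h3 : ‖q‖ ^ k ≤ 1 := pow_le_one₀ (norm_nonneg _) hq.le
  nlinarith [norm_nonneg a]

lemma qPoch_ne_zero {a q : ℂ} (ha : ‖a‖ < 1) (hq : ‖q‖ < 1) (n : ℕ) : qPoch a q n ≠ 0 :=
  Finset.prod_ne_zero_iff.2 fun k _ => one_sub_mul_pow_ne_zero ha hq k

lemma summable_norm_neg_mul_pow (a : ℂ) {q : ℂ} (hq : ‖q‖ < 1) :
    Summable fun k : ℕ => ‖-(a * q ^ k)‖ := by
  simp only [norm_neg, norm_mul, norm_pow]
  exact (summable_geometric_of_lt_one (norm_nonneg _) hq).mul_left _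

lemma multipliable_one_sub_mul_pow (a : ℂ) {q : ℂ} (hq : ‖q‖ < 1) :
    Multipliable fun k : ℕ => 1 - a * q ^ k := by
  simpa only [sub_eq_add_neg] using
    multipliable_one_add_of_summable (summable_norm_neg_mul_pow a hq)

lemma tendsto_qPoch (a : ℂ) {q : ℂ} (hq : ‖q‖ < 1) :
    Tendsto (qPoch a q) atTop (𝓝 (qPochInf a q)) :=
  (multipliable_one_sub_mul_pow a hq).tendsto_prod_tprod_nat

lemma qPochInf_ne_zero {a q : ℂ} (ha : ‖a‖ < 1) (hq : ‖q‖ < 1) : qPochInf a q ≠ 0 := by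
  have h := tprod_one_add_ne_zero_of_summable (f := fun k : ℕ => -(a * q ^ k))
    (fun k => by simpa [sub_eq_add_neg] using one_sub_mul_pow_ne_zero ha hq k)
    (summable_norm_neg_mul_pow a hq)
  simpa [qPochInf, sub_eq_add_neg] using h

lemma tendsto_qPoch_inv {q : ℂ} (hq : ‖q‖ < 1) :
    Tendsto (fun n => (qPoch q q n)⁻¹) atTop (𝓝 (qPochInf q q)⁻¹) :=
  (tendsto_qPoch q hq).inv₀ (qPochInf_ne_zero hq hq)

lemma exists_norm_qPoch_inv_le {q : ℂ} (hq : ‖q‖ < 1) :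
    ∃ C : ℝ, 1 ≤ C ∧ ∀ n, ‖(qPoch q q n)⁻¹‖ ≤ C := by
  obtain ⟨C, hC⟩ := (Metric.isBounded_range_of_tendsto _ (tendsto_qPoch_inv hq)).exists_norm_le
  exact ⟨C, by simpa using hC _ ⟨0, rfl⟩, fun n => hC _ ⟨n, rfl⟩⟩

lemma qPoch_mul_qPochInf (a : ℂ) {q : ℂ} (hq : ‖q‖ < 1) (n : ℕ) :
    qPoch a q n * qPochInf (a * q ^ n) q = qPochInf a q := by
  have h := tendsto_nhds_unique ((tendsto_qPoch a hq).comp (tendsto_add_atTop_nat n))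
    (((tendsto_qPoch (a * q ^ n) hq).const_mul (qPoch a q n)).congr fun m => ?_)
  · exact h.symm
  · simp only [Function.comp_apply, qPoch]
    rw [add_comm m n, Finset.prod_range_add]
    congr 1
    exact Finset.prod_congr rfl fun k _ => by ring

lemma norm_sq_lt_one {q : ℂ} (hq : ‖q‖ < 1) : ‖q ^ 2‖ < 1 := by
  rw [norm_pow]; exact pow_lt_one₀ (norm_nonneg _) hq two_ne_zero

/-- Factorwise `(1 - x)(1 + x) = 1 - x²`; this is the mechanism that doubles the base. -/
lemma qPoch_mul_qPoch_neg (q : ℂ) (n : ℕ) :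
    qPoch q q n * qPoch (-q) q n = qPoch (q ^ 2) (q ^ 2) n := by
  simp only [qPoch, ← Finset.prod_mul_distrib]
  exact Finset.prod_congr rfl fun k _ => by ring

lemma qPochInf_mul_qPochInf_neg {q : ℂ} (hq : ‖q‖ < 1) :
    qPochInf q q * qPochInf (-q) q = qPochInf (q ^ 2) (q ^ 2) :=
  tendsto_nhds_unique (((tendsto_qPoch q hq).mul (tendsto_qPoch (-q) hq)).congr
    (qPoch_mul_qPoch_neg q)) (tendsto_qPoch _ (norm_sq_lt_one hq))

lemma choose_succ_two (n : ℕ) : (n + 1).choose 2 = n.choose 2 + n := by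
  rw [Nat.choose_succ_succ' n 1, Nat.choose_one_right, add_comm]

lemma hasSum_of_fiberwise {α β : Type*} {f : α × β → ℂ} {g : α → ℂ} {a : ℂ} (hf : Summable f)
    (h₁ : ∀ b, HasSum (fun c => f (b, c)) (g b)) (h₂ : HasSum g a) : HasSum f a := by
  have h := hf.hasSum.prod_fiberwise h₁
  rw [h₂.unique h]
  exact hf.hasSum

/-! ### Euler's identity -/

lemma summable_euler {x q : ℂ} (hx : ‖x‖ < 1) (hq : ‖q‖ < 1) :
    Summable fun i : ℕ => q ^ i.choose 2 * x ^ i / qPoch q q i := by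
  obtain ⟨C, hC1, hC⟩ := exists_norm_qPoch_inv_le hq
  refine Summable.of_norm_bounded
    ((summable_geometric_of_lt_one (norm_nonneg x) hx).mul_right C) fun i => ?_
  rw [div_eq_mul_inv, norm_mul, norm_mul, norm_pow, norm_pow]
  have : ‖q‖ ^ i.choose 2 ≤ 1 := pow_le_one₀ (norm_nonneg _) hq.le
  gcongr
  · exact mul_le_of_le_one_left (by positivity) this
  · exact hC i

/-- In the difference of the series at `x` and at `xq` the factor `1 - q^i` cancels the last factor
of `(q;q)_i`; shifting `i` returns `x` times the series at `xq`. -/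
lemma euler_functional_equation {x q : ℂ} (hx : ‖x‖ < 1) (hq : ‖q‖ < 1) :
    ∑' i : ℕ, q ^ i.choose 2 * x ^ i / qPoch q q i =
      (1 + x) * ∑' i : ℕ, q ^ i.choose 2 * (x * q) ^ i / qPoch q q i := by
  have hxq : ‖x * q‖ < 1 := by
    rw [norm_mul]; nlinarith [norm_nonneg x, norm_nonneg q]
  have s1 := summable_euler hx hq
  have s2 := summable_euler hxq hq
  have h : ∑' i : ℕ, (q ^ i.choose 2 * x ^ i / qPoch q q i -
      q ^ i.choose 2 * (x * q) ^ i / qPoch q q i) =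
      x * ∑' i : ℕ, q ^ i.choose 2 * (x * q) ^ i / qPoch q q i := by
    rw [(s1.sub s2).tsum_eq_zero_add, ← tsum_mul_left]
    simp only [Nat.choose_zero_succ, pow_zero, qPoch_zero, sub_self, zero_add]
    refine tsum_congr fun i => ?_
    have h0 := qPoch_ne_zero hq hq i
    have h1 := one_sub_mul_pow_ne_zero hq hq i
    rw [qPoch_succ, choose_succ_two]
    field_simp
    ring
  rw [s1.tsum_sub s2] at h
  linear_combination h

/-- Euler's identity `∑ q^{i(i-1)/2} x^i / (q; q)_i = (-x; q)_∞`. -/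
theorem hasSum_euler {x q : ℂ} (hx : ‖x‖ < 1) (hq : ‖q‖ < 1) :
    HasSum (fun i : ℕ => q ^ i.choose 2 * x ^ i / qPoch q q i) (qPochInf (-x) q) := by
  set L : ℂ → ℂ := fun y => ∑' i : ℕ, q ^ i.choose 2 * y ^ i / qPoch q q i with hL
  have hxn : ∀ n : ℕ, ‖x * q ^ n‖ < 1 := fun n => by
    rw [norm_mul, norm_pow]
    exact (mul_le_of_le_one_right (norm_nonneg _)
      (pow_le_one₀ (norm_nonneg _) hq.le)).trans_lt hx
  -- Iterating the functional equation builds up the product; only the constant term of `L (x q^n)`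
  -- survives as `n → ∞`.
  have hit : ∀ n : ℕ, L x = qPoch (-x) q n * L (x * q ^ n) := by
    intro n
    induction n with
    | zero => simp
    | succ n ih =>
      rw [ih, qPoch_succ, hL]
      simp only
      rw [euler_functional_equation (hxn n) hq, pow_succ, mul_assoc x]
      ring
  have hlim : Tendsto (fun n : ℕ => L (x * q ^ n)) atTop (𝓝 1) := by
    obtain ⟨C, hC1, hC⟩ := exists_norm_qPoch_inv_le hq
    have h1 : (1 : ℂ) = ∑' i : ℕ, (if i = 0 then (1 : ℂ) else 0) := by simp
    rw [h1]
    refine tendsto_tsum_of_dominated_convergence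
      ((summable_geometric_of_lt_one (norm_nonneg x) hx).mul_right C) (fun i => ?_)
      (Eventually.of_forall fun n i => ?_)
    · rcases Nat.eq_zero_or_pos i with rfl | hi
      · simp
      · have ht : Tendsto (fun n : ℕ => x * q ^ n) atTop (𝓝 0) := by
          simpa using (tendsto_pow_atTop_nhds_zero_of_norm_lt_one hq).const_mul x
        have := ((ht.pow i).const_mul (q ^ i.choose 2)).div_const (qPoch q q i)
        simpa [hi.ne'] using this
    · rw [div_eq_mul_inv, norm_mul, norm_mul, norm_pow, norm_pow]
      have h2 : ‖q‖ ^ i.choose 2 ≤ 1 := pow_le_one₀ (norm_nonneg _) hq.le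
      have h3 : ‖x * q ^ n‖ ≤ ‖x‖ := by
        rw [norm_mul, norm_pow]
        exact mul_le_of_le_one_right (norm_nonneg _) (pow_le_one₀ (norm_nonneg _) hq.le)
      gcongr
      · calc ‖q‖ ^ i.choose 2 * ‖x * q ^ n‖ ^ i ≤ 1 * ‖x‖ ^ i := by gcongr
          _ = ‖x‖ ^ i := one_mul _
      · exact hC i
  have := tendsto_nhds_unique
    ((((tendsto_qPoch (-x) hq).mul hlim)).congr fun n => (hit n).symm) tendsto_const_nhds
  rw [mul_one] at this
  rw [this]
  exact (summable_euler hx hq).hasSum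

/-! ### Cauchy's identity -/

lemma summable_cauchy {q : ℂ} (hq : ‖q‖ < 1) (a e : ℕ) :
    Summable fun t : ℕ => q ^ (t ^ 2 + e * t) / (qPoch q q t * qPoch q q (t + a)) := by
  obtain ⟨C, hC1, hC⟩ := exists_norm_qPoch_inv_le hq
  refine Summable.of_norm_bounded
    ((summable_geometric_of_lt_one (norm_nonneg q) hq).mul_right (C * C)) fun t => ?_
  rw [div_eq_mul_inv, mul_inv, norm_mul, norm_mul, norm_pow]
  have : ‖q‖ ^ (t ^ 2 + e * t) ≤ ‖q‖ ^ t :=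
    pow_le_pow_of_le_one (norm_nonneg _) hq.le (by nlinarith [Nat.zero_le (e * t), Nat.le_self_pow two_ne_zero t])
  gcongr
  · exact hC t
  · exact hC _

/-- The Durfee rectangle series `∑ q^{t² + e t} / ((q; q)_t (q; q)_{t + a})`. -/
def cauchySeries (q : ℂ) (a e : ℕ) : ℂ :=
  ∑' t : ℕ, q ^ (t ^ 2 + e * t) / (qPoch q q t * qPoch q q (t + a))

/-- Write `1/(q;q)_{t+a} = (1 - q^{t+a+1})/(q;q)_{t+a+1}` and split. -/
lemma cauchySeries_left {q : ℂ} (hq : ‖q‖ < 1) (a e : ℕ) :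
    cauchySeries q a e =
      cauchySeries q (a + 1) e - q ^ (a + 1) * cauchySeries q (a + 1) (e + 1) := by
  rw [cauchySeries, cauchySeries, cauchySeries, ← tsum_mul_left,
    ← (summable_cauchy hq _ _).tsum_sub ((summable_cauchy hq _ _).mul_left _)]
  refine tsum_congr fun t => ?_
  have h0 := qPoch_ne_zero hq hq t
  have h1 := qPoch_ne_zero hq hq (t + a)
  have h2 := one_sub_mul_pow_ne_zero hq hq (t + a)
  rw [← add_assoc, qPoch_succ]
  field_simp
  ring

/-- The factor `1 - q^t` kills the term `t = 0` and cancels the last factor of `(q;q)_t`; then `t`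
is shifted by one. -/
lemma cauchySeries_right {q : ℂ} (hq : ‖q‖ < 1) (a e : ℕ) :
    cauchySeries q a e - cauchySeries q a (e + 1) =
      q ^ (e + 1) * cauchySeries q (a + 1) (e + 2) := by
  rw [cauchySeries, cauchySeries, cauchySeries, ← tsum_mul_left,
    ← (summable_cauchy hq _ _).tsum_sub (summable_cauchy hq _ _),
    ((summable_cauchy hq _ _).sub (summable_cauchy hq _ _)).tsum_eq_zero_add]
  simp only [ne_eq, OfNat.ofNat_ne_zero, not_false_eq_true, zero_pow, mul_zero, add_zero, pow_zero,
    sub_self, zero_add]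
  refine tsum_congr fun t => ?_
  have h0 := qPoch_ne_zero hq hq t
  have h1 := qPoch_ne_zero hq hq (t + a + 1)
  have h2 := one_sub_mul_pow_ne_zero hq hq t
  rw [show t + 1 + a = t + a + 1 by ring, ← add_assoc, qPoch_succ q q t]
  field_simp
  ring

lemma exists_norm_cauchySeries_le {q : ℂ} (hq : ‖q‖ < 1) :
    ∃ B : ℝ, ∀ a e, ‖cauchySeries q a e‖ ≤ B := by
  obtain ⟨C, hC1, hC⟩ := exists_norm_qPoch_inv_le hq
  refine ⟨∑' t : ℕ, ‖q‖ ^ t * (C * C), fun a e => tsum_of_norm_bounded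
    ((summable_geometric_of_lt_one (norm_nonneg q) hq).mul_right (C * C)).hasSum fun t => ?_⟩
  rw [div_eq_mul_inv, mul_inv, norm_mul, norm_mul, norm_pow]
  have : ‖q‖ ^ (t ^ 2 + e * t) ≤ ‖q‖ ^ t :=
    pow_le_pow_of_le_one (norm_nonneg _) hq.le (by nlinarith [Nat.zero_le (e * t), Nat.le_self_pow two_ne_zero t])
  gcongr
  · exact hC t
  · exact hC _

/-- The two contiguous relations show that consecutive differences on the diagonal satisfy `D_a =
-q^{a+1} D_{a+1}`. As all `D_a` are uniformly bounded, iterating this forces `D_a = 0`. -/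
lemma cauchySeries_succ {q : ℂ} (hq : ‖q‖ < 1) (a : ℕ) :
    cauchySeries q (a + 1) (a + 1) = cauchySeries q a a := by
  obtain ⟨B, hB⟩ := exists_norm_cauchySeries_le hq
  have hrec : ∀ a, cauchySeries q a a - cauchySeries q (a + 1) (a + 1) =
      -q ^ (a + 1) * (cauchySeries q (a + 1) (a + 1) - cauchySeries q (a + 2) (a + 2)) := by
    intro a
    have h1 := cauchySeries_left hq a a
    have h2 := cauchySeries_right hq (a + 1) a
    linear_combination h1 + h2
  have hle : ∀ n a, ‖cauchySeries q a a - cauchySeries q (a + 1) (a + 1)‖ ≤ ‖q‖ ^ n * (B + B) := by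
    intro n
    induction n with
    | zero => intro a; simpa using (norm_sub_le _ _).trans (add_le_add (hB _ _) (hB _ _))
    | succ n ih =>
      intro a
      rw [hrec, norm_mul, norm_neg, norm_pow, pow_succ' ‖q‖ n, mul_assoc]
      have : ‖q‖ ^ (a + 1) ≤ ‖q‖ := pow_le_of_le_one (norm_nonneg _) hq.le (by simp)
      gcongr
      exact ih (a + 1)
  have hlim : Tendsto (fun n : ℕ => ‖q‖ ^ n * (B + B)) atTop (𝓝 0) := by
    simpa using (tendsto_pow_atTop_nhds_zero_of_lt_one (norm_nonneg _) hq).mul_const (B + B)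
  have := ge_of_tendsto' hlim fun n => hle n a
  exact (sub_eq_zero.1 (norm_le_zero_iff.1 this)).symm

/-- The diagonal value does not depend on `a`, and as `a → ∞` only the term `t = 0` survives. -/
theorem cauchySeries_eq {q : ℂ} (hq : ‖q‖ < 1) (a : ℕ) :
    cauchySeries q a a = (qPochInf q q)⁻¹ := by
  have hc : ∀ a, cauchySeries q a a = cauchySeries q 0 0 := fun a => by
    induction a with
    | zero => rfl
    | succ a ih => rw [cauchySeries_succ hq, ih]
  have hlim : Tendsto (fun a : ℕ => cauchySeries q a a) atTop (𝓝 (qPochInf q q)⁻¹) := by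
    obtain ⟨C, hC1, hC⟩ := exists_norm_qPoch_inv_le hq
    have h1 : (qPochInf q q)⁻¹ = ∑' i : ℕ, (if i = 0 then (qPochInf q q)⁻¹ else 0) := by simp
    rw [h1]
    refine tendsto_tsum_of_dominated_convergence
      ((summable_geometric_of_lt_one (norm_nonneg q) hq).mul_right (C * C)) (fun t => ?_)
      (Eventually.of_forall fun n t => ?_)
    · rcases Nat.eq_zero_or_pos t with rfl | ht
      · simpa using tendsto_qPoch_inv hq
      · have h2 : Tendsto (fun a : ℕ => (q ^ t) ^ a) atTop (𝓝 0) :=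
          tendsto_pow_atTop_nhds_zero_of_norm_lt_one (by
            rw [norm_pow]; exact pow_lt_one₀ (norm_nonneg _) hq ht.ne')
        have h3 := (tendsto_qPoch_inv hq).comp (tendsto_add_atTop_nat t)
        have h4 := ((h2.const_mul (q ^ t ^ 2)).mul h3).mul_const (qPoch q q t)⁻¹
        simp only [mul_zero, zero_mul] at h4
        simp only [ht.ne', if_false]
        refine h4.congr fun a => ?_
        simp only [Function.comp_apply, div_eq_mul_inv, mul_inv, pow_add, ← pow_mul, mul_comm t a, add_comm t a]
        ring
    · rw [div_eq_mul_inv, mul_inv, norm_mul, norm_mul, norm_pow]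
      have : ‖q‖ ^ (t ^ 2 + n * t) ≤ ‖q‖ ^ t :=
        pow_le_pow_of_le_one (norm_nonneg _) hq.le
          (by nlinarith [Nat.zero_le (n * t), Nat.le_self_pow two_ne_zero t])
      gcongr
      · exact hC t
      · exact hC _
  rw [hc a]
  exact tendsto_nhds_unique (tendsto_const_nhds.congr fun a => (hc a).symm) hlim

theorem hasSum_cauchy {q : ℂ} (hq : ‖q‖ < 1) (a : ℕ) :
    HasSum (fun t : ℕ => q ^ (t ^ 2 + a * t) / (qPoch q q t * qPoch q q (t + a)))
      (qPochInf q q)⁻¹ := by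
  rw [← cauchySeries_eq hq a]
  exact (summable_cauchy hq a a).hasSum

lemma hasSum_sum_antidiagonal {f : ℕ × ℕ → ℂ} {a : ℂ} (h : HasSum f a) :
    HasSum (fun n => ∑ p ∈ Finset.HasAntidiagonal.antidiagonal n, f p) a := by
  have h1 := (Finset.HasAntidiagonal.sigmaAntidiagonalEquivProd (A := ℕ)).hasSum_iff.2 h
  refine h1.sigma fun n => ?_
  have h2 := hasSum_fintype (fun c : Finset.HasAntidiagonal.antidiagonal n => f c)
  rw [Finset.sum_coe_sort (Finset.HasAntidiagonal.antidiagonal n) f] at h2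
  exact h2

/-! ### The Jacobi triple product -/

/-- Pairs of natural numbers, indexed by the signed difference and the minimum of the entries. -/
def natProdEquivDiffMin : (ℕ ⊕ ℕ) × ℕ ≃ ℕ × ℕ where
  toFun p := Sum.elim (fun a => (p.2 + a, p.2)) (fun b => (p.2, p.2 + b + 1)) p.1
  invFun p := if p.2 ≤ p.1 then (Sum.inl (p.1 - p.2), p.2) else (Sum.inr (p.2 - p.1 - 1), p.1)
  left_inv := by
    rintro ⟨a | b, t⟩
    · simp
    · have h : ¬ t + b + 1 ≤ t := by omega
      have h' : t + b + 1 - t - 1 = b := by omega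
      simp [h, h']
  right_inv := by
    rintro ⟨i, j⟩
    by_cases h : j ≤ i
    · simp [h]
    · simp only [h, if_false, Sum.elim_inr, Prod.mk.injEq, true_and]
      omega

lemma choose_two_add (a t : ℕ) :
    (t + a).choose 2 + t.choose 2 + t = a.choose 2 + (t ^ 2 + a * t) := by
  induction t with
  | zero => simp
  | succ t ih =>
    rw [show t + 1 + a = (t + a) + 1 by ring, choose_succ_two, choose_succ_two]
    linear_combination ih

/-- The terms of the theta series `∑ (-1)^n x^{n(n+1)/2} y^{n(n-1)/2}`, where the nonnegative and
the negative indices are listed separately. -/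
def jacobiTerm (x y : ℂ) : ℕ ⊕ ℕ → ℂ :=
  Sum.elim (fun a => (-1) ^ a * ((x * y) ^ a.choose 2 * x ^ a))
    (fun b => (-1) ^ (b + 1) * ((x * y) ^ (b + 1).choose 2 * y ^ (b + 1)))

/-- The Jacobi triple product identity. -/
theorem hasSum_jacobiTerm {x y : ℂ} (hx : ‖x‖ < 1) (hy : ‖y‖ < 1) :
    HasSum (jacobiTerm x y) (qPochInf₃ x y (x * y) (x * y)) := by
  set Q := x * y with hQdef
  have hQ : ‖Q‖ < 1 := by rw [norm_mul]; nlinarith [norm_nonneg x, norm_nonneg y]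
  have ex := hasSum_euler (x := -x) (by simpa using hx) hQ
  have ey := hasSum_euler (x := -y) (by simpa using hy) hQ
  rw [neg_neg] at ex ey
  have hs := summable_mul_of_summable_norm ex.summable.norm ey.summable.norm
  have h1 := natProdEquivDiffMin.hasSum_iff.2 (ex.mul ey hs)
  have h2 : HasSum (fun s => jacobiTerm x y s * (qPochInf Q Q)⁻¹)
      (qPochInf x Q * qPochInf y Q) := by
    -- In the product of the two Euler series, the pairs with a fixed difference of indices form a
    -- Cauchy series in the smaller index `t`. Its value does not depend on the difference, so the
    -- theta term factors out.
    refine h1.prod_fiberwise ?_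
    have hneg : ∀ (z : ℂ) (a t : ℕ), (-z) ^ (t + a) = (-1) ^ a * ((-1) ^ t * z ^ t * z ^ a) :=
      fun z a t => by rw [neg_eq_neg_one_mul, mul_pow, pow_add, pow_add]; ring
    have hsq : ∀ t : ℕ, ((-1 : ℂ) ^ t) * (-1) ^ t = 1 := fun t => by
      rw [← mul_pow]; simp
    rintro (a | b)
    · refine ((hasSum_cauchy hQ a).mul_left (jacobiTerm x y (Sum.inl a))).congr_fun fun t => ?_
      have h3 : Q ^ (t + a).choose 2 * Q ^ t.choose 2 * Q ^ t = Q ^ a.choose 2 * Q ^ (t ^ 2 + a * t) := by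
        rw [← pow_add, ← pow_add, ← pow_add, choose_two_add]
      have h4 : Q ^ t = x ^ t * y ^ t := by rw [hQdef, mul_pow]
      rw [h4] at h3
      simp only [Function.comp_apply, natProdEquivDiffMin, Equiv.coe_fn_mk, Sum.elim_inl,
        jacobiTerm, ← hQdef]
      rw [div_mul_div_comm, hneg x a t, ← mul_div_assoc, mul_comm (qPoch Q Q t)]
      congr 1
      have h5 := hneg y 0 t
      simp only [add_zero, pow_zero, one_mul, mul_one] at h5
      rw [h5]
      linear_combination (-1) ^ a * x ^ a * (-1) ^ t * (-1) ^ t * h3 +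
        (-1) ^ a * x ^ a * Q ^ a.choose 2 * Q ^ (t ^ 2 + a * t) * hsq t
    · refine ((hasSum_cauchy hQ (b + 1)).mul_left (jacobiTerm x y (Sum.inr b))).congr_fun
        fun t => ?_
      have h3 : Q ^ (t + (b + 1)).choose 2 * Q ^ t.choose 2 * Q ^ t =
          Q ^ (b + 1).choose 2 * Q ^ (t ^ 2 + (b + 1) * t) := by
        rw [← pow_add, ← pow_add, ← pow_add, choose_two_add]
      have h4 : Q ^ t = x ^ t * y ^ t := by rw [hQdef, mul_pow]
      rw [h4] at h3
      simp only [Function.comp_apply, natProdEquivDiffMin, Equiv.coe_fn_mk, Sum.elim_inr,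
        jacobiTerm, ← hQdef]
      rw [div_mul_div_comm, add_assoc t b 1, hneg y (b + 1) t, ← mul_div_assoc]
      congr 1
      have h5 := hneg x 0 t
      simp only [add_zero, pow_zero, one_mul, mul_one] at h5
      rw [h5]
      linear_combination (-1) ^ (b + 1) * y ^ (b + 1) * (-1) ^ t * (-1) ^ t * h3 +
        (-1) ^ (b + 1) * y ^ (b + 1) * Q ^ (b + 1).choose 2 * Q ^ (t ^ 2 + (b + 1) * t) * hsq t
  have h0 := qPochInf_ne_zero hQ hQ
  have h3 := h2.mul_right (qPochInf Q Q)
  simpa [mul_assoc, h0, qPochInf₃] using h3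

/-! ### Finite forms of the pentagonal number theorem -/

lemma qPoch_inv_eq {q : ℂ} (hq : ‖q‖ < 1) (n : ℕ) :
    (qPoch q q n)⁻¹ = (1 - q ^ (n + 1)) * (qPoch q q (n + 1))⁻¹ := by
  have h0 := qPoch_ne_zero hq hq n
  have h1 := one_sub_mul_pow_ne_zero hq hq n
  rw [qPoch_succ, pow_succ' q n]
  field_simp

/-- Weights of the finite pentagonal number identity. -/
def pentWeight (q : ℂ) (m : ℕ) : ℂ :=
  if m = 0 then 1 else (-1) ^ m * q ^ (m + 3 * m.choose 2) * (1 + q ^ m)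

/-- Weights of the odd companion of the finite pentagonal number identity. -/
def pentWeightOdd (q : ℂ) (m : ℕ) : ℂ :=
  (-1) ^ m * q ^ (2 * m + 3 * m.choose 2) * (1 - q ^ (2 * m + 1))

/-- A telescoping certificate: the summand of the recurrence in `s` has partial sums in closed form,
which makes the induction on `M` a polynomial identity. -/
lemma sum_pentWeight_partial {q : ℂ} (hq : ‖q‖ < 1) (s M : ℕ) (hM : M ≤ s) :
    ∑ m ∈ Finset.range (M + 1), pentWeight q m *
      ((1 - q ^ (s + 1)) * ((qPoch q q (s + 1 - m))⁻¹ * (qPoch q q (s + 1 + m))⁻¹) -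
        (qPoch q q (s - m))⁻¹ * (qPoch q q (s + m))⁻¹) =
    (-1) ^ M * q ^ (s + 1 + 3 * (M + 1).choose 2) *
      ((qPoch q q (s - M))⁻¹ * (qPoch q q (s + M + 1))⁻¹) := by
  induction M with
  | zero =>
    simp only [zero_add, Finset.range_one, Finset.sum_singleton, pentWeight, if_true, tsub_zero,
      add_zero]
    have h := qPoch_inv_eq hq s
    have hc : Nat.choose 1 2 = 0 := rfl
    rw [h, hc]
    ring
  | succ M ih =>
    obtain ⟨t, rfl⟩ := Nat.exists_eq_add_of_le hM
    rw [Finset.sum_range_succ, ih (by omega)]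
    have e1 : M + 1 + t - M = t + 1 := by omega
    have e2 : M + 1 + t + 1 - (M + 1) = t + 1 := by omega
    have e3 : M + 1 + t - (M + 1) = t := by omega
    have e4 : M + 1 + t + 1 + (M + 1) = M + 1 + t + M + 1 + 1 := by omega
    have e5 : M + 1 + t + (M + 1) = M + 1 + t + M + 1 := by omega
    rw [e1, e2, e3, e4, e5, qPoch_inv_eq hq t, qPoch_inv_eq hq (M + 1 + t + M + 1),
      choose_succ_two (M + 1), pentWeight, if_neg (Nat.succ_ne_zero M)]
    generalize (qPoch q q (t + 1))⁻¹ = X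
    generalize (qPoch q q (M + 1 + t + M + 1 + 1))⁻¹ = Y
    generalize (M + 1).choose 2 = c
    ring

theorem sum_pentWeight {q : ℂ} (hq : ‖q‖ < 1) (s : ℕ) :
    ∑ m ∈ Finset.range (s + 1), pentWeight q m *
      ((qPoch q q (s - m))⁻¹ * (qPoch q q (s + m))⁻¹) = (qPoch q q s)⁻¹ := by
  induction s with
  | zero => simp [pentWeight]
  | succ s ih =>
    have hd : (1 - q ^ (s + 1)) ≠ 0 := by
      rw [pow_succ']; exact one_sub_mul_pow_ne_zero hq hq s
    apply mul_left_cancel₀ hd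
    rw [← qPoch_inv_eq hq s, ← ih, ← sub_eq_zero, Finset.mul_sum, Finset.sum_range_succ]
    -- What remains at `M = s` is cancelled by the new term `m = s + 1`, because `(1 - q^{s+1})(1 +
    -- q^{s+1}) = 1 - q^{2s+2}`.
    have h := sum_pentWeight_partial hq s s le_rfl
    simp only [mul_sub, Finset.sum_sub_distrib] at h
    have e1 : s + 1 + (s + 1) = s + s + 1 + 1 := by omega
    have e2 := qPoch_inv_eq hq (s + s + 1)
    rw [e2] at h
    simp only [mul_left_comm (1 - q ^ (s + 1))] at h ⊢
    rw [pentWeight, if_neg (Nat.succ_ne_zero s), e1]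
    simp only [tsub_self, qPoch_zero] at h ⊢
    linear_combination h

theorem sum_pentWeightOdd {q : ℂ} (hq : ‖q‖ < 1) (s : ℕ) :
    ∑ m ∈ Finset.range (s + 1), pentWeightOdd q m *
      ((qPoch q q (s - m))⁻¹ * (qPoch q q (s + m + 1))⁻¹) = (qPoch q q s)⁻¹ := by
  induction s with
  | zero =>
    have h := one_sub_mul_pow_ne_zero hq hq 0
    simp only [pow_zero, mul_one] at h
    simp [pentWeightOdd, qPoch_succ, h]
  | succ s ih =>
    -- For `m > 0` the even weight splits as `(q^m + q^{2m}) v m`. Raising `s` by one adds to the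
    -- odd sum exactly `q^{s+1}` times the even sum at `s + 1`, so the even identity closes the
    -- induction.
    set v : ℕ → ℂ := fun m => (-1) ^ m * q ^ (3 * m.choose 2) *
      ((qPoch q q (s + 1 - m))⁻¹ * (qPoch q q (s + 1 + m))⁻¹) with hv
    have hterm : ∀ m ∈ Finset.range (s + 1),
        pentWeightOdd q m * ((qPoch q q (s + 1 - m))⁻¹ * (qPoch q q (s + 1 + m + 1))⁻¹) =
        pentWeightOdd q m * ((qPoch q q (s - m))⁻¹ * (qPoch q q (s + m + 1))⁻¹) +
          q ^ (s + 1) * (q ^ m * v m + q ^ (2 * (m + 1)) * v (m + 1)) := by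
      intro m hm
      obtain ⟨t, rfl⟩ := Nat.exists_eq_add_of_le (Nat.lt_succ_iff.1 (Finset.mem_range.1 hm))
      have e1 : m + t + 1 - m = t + 1 := by omega
      have e2 : m + t - m = t := by omega
      have e3 : m + t + 1 - (m + 1) = t := by omega
      have e4 : m + t + 1 + m = m + t + m + 1 := by omega
      have e5 : m + t + 1 + (m + 1) = m + t + m + 1 + 1 := by omega
      simp only [hv]
      rw [e1, e2, e3, e4, e5, qPoch_inv_eq hq t, qPoch_inv_eq hq (m + t + m + 1),
        choose_succ_two, pentWeightOdd]
      generalize (qPoch q q (t + 1))⁻¹ = X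
      generalize (qPoch q q (m + t + m + 1 + 1))⁻¹ = Y
      generalize m.choose 2 = c
      ring
    have hlast : pentWeightOdd q (s + 1) *
        ((qPoch q q (s + 1 - (s + 1)))⁻¹ * (qPoch q q (s + 1 + (s + 1) + 1))⁻¹) =
        q ^ (s + 1) * (q ^ (s + 1) * v (s + 1)) := by
      simp only [hv, tsub_self]
      rw [qPoch_inv_eq hq (s + 1 + (s + 1)), pentWeightOdd]
      ring
    have hw : ∑ m ∈ Finset.range (s + 2), q ^ m * v m +
        ∑ m ∈ Finset.range (s + 1), q ^ (2 * (m + 1)) * v (m + 1) = (qPoch q q (s + 1))⁻¹ := by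
      rw [← sum_pentWeight hq (s + 1), Finset.sum_range_succ', Finset.sum_range_succ' _ (s + 1),
        add_right_comm, ← Finset.sum_add_distrib]
      congr 1
      · refine Finset.sum_congr rfl fun m _ => ?_
        simp only [hv, pentWeight, Nat.succ_ne_zero, if_false]
        ring
      · simp [hv, pentWeight]
    rw [Finset.sum_range_succ, Finset.sum_congr rfl hterm, Finset.sum_add_distrib, ih, hlast,
      ← Finset.mul_sum, Finset.sum_add_distrib]
    rw [Finset.sum_range_succ] at hw
    rw [qPoch_inv_eq hq s]
    linear_combination q ^ (s + 1) * hw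

/-! ### The Rogers–Ramanujan identities -/

/-- A limiting case of Bailey's lemma. With `s = m + t`, `s² + es = (m² + em) + (t² + (2m + e)t)`:
summing the double series over `t` first is Cauchy's identity, and summing it along `m + t = s` is
`hfin`. The bound on `w` gives absolute convergence. -/
lemma hasSum_of_sum_weight {q : ℂ} (hq : ‖q‖ < 1) {w : ℕ → ℂ} {e : ℕ} {T : ℂ}
    (hw : ∀ m, ‖w m‖ ≤ 2)
    (hfin : ∀ s, ∑ m ∈ Finset.range (s + 1), w m *
      ((qPoch q q (s - m))⁻¹ * (qPoch q q (s + m + e))⁻¹) = (qPoch q q s)⁻¹)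
    (hT : HasSum (fun m => w m * q ^ (m ^ 2 + e * m)) T) :
    HasSum (fun s : ℕ => q ^ (s ^ 2 + e * s) / qPoch q q s) (T / qPochInf q q) := by
  set f : ℕ × ℕ → ℂ := fun p => w p.1 * q ^ (p.1 ^ 2 + e * p.1) *
    (q ^ (p.2 ^ 2 + (2 * p.1 + e) * p.2) / (qPoch q q p.2 * qPoch q q (p.2 + (2 * p.1 + e)))) with hf
  have hsum : Summable f := by
    obtain ⟨C, hC1, hC⟩ := exists_norm_qPoch_inv_le hq
    have hg := summable_geometric_of_lt_one (norm_nonneg q) hq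
    refine Summable.of_norm_bounded ((hg.mul_of_nonneg hg (fun _ => by positivity)
      (fun _ => by positivity)).mul_left (2 * (C * C))) fun p => ?_
    simp only [hf, div_eq_mul_inv, mul_inv, norm_mul, norm_pow]
    have h1 : ‖q‖ ^ (p.1 ^ 2 + e * p.1) ≤ ‖q‖ ^ p.1 :=
      pow_le_pow_of_le_one (norm_nonneg _) hq.le
        (by nlinarith [Nat.zero_le (e * p.1), Nat.le_self_pow two_ne_zero p.1])
    have h2 : ‖q‖ ^ (p.2 ^ 2 + (2 * p.1 + e) * p.2) ≤ ‖q‖ ^ p.2 :=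
      pow_le_pow_of_le_one (norm_nonneg _) hq.le
        (by nlinarith [Nat.zero_le ((2 * p.1 + e) * p.2), Nat.le_self_pow two_ne_zero p.2])
    calc ‖w p.1‖ * ‖q‖ ^ (p.1 ^ 2 + e * p.1) * (‖q‖ ^ (p.2 ^ 2 + (2 * p.1 + e) * p.2) *
          (‖(qPoch q q p.2)⁻¹‖ * ‖(qPoch q q (p.2 + (2 * p.1 + e)))⁻¹‖))
        ≤ 2 * ‖q‖ ^ p.1 * (‖q‖ ^ p.2 * (C * C)) := by
          gcongr
          · exact hw _
          · exact hC _
          · exact hC _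
      _ = 2 * (C * C) * (‖q‖ ^ p.1 * ‖q‖ ^ p.2) := by ring
  have h1 : HasSum f (T / qPochInf q q) :=
    hasSum_of_fiberwise hsum (g := fun m => w m * q ^ (m ^ 2 + e * m) * (qPochInf q q)⁻¹)
      (fun m => (hasSum_cauchy hq (2 * m + e)).mul_left (w m * q ^ (m ^ 2 + e * m)))
      (by rw [div_eq_mul_inv]; exact hT.mul_right _)
  refine (hasSum_sum_antidiagonal h1).congr_fun fun s => ?_
  rw [Finset.Nat.sum_antidiagonal_eq_sum_range_succ_mk, div_eq_mul_inv, ← hfin s, Finset.mul_sum]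
  refine Finset.sum_congr rfl fun m hm => ?_
  obtain ⟨t, rfl⟩ := Nat.exists_eq_add_of_le (Nat.lt_succ_iff.1 (Finset.mem_range.1 hm))
  have e1 : m + t - m = t := by omega
  have e2 : m + t + m + e = t + (2 * m + e) := by omega
  simp only [hf]
  rw [e1, e2, div_eq_mul_inv, mul_inv]
  ring

lemma norm_neg_one_pow_mul_pow_mul_le {q z : ℂ} (hq : ‖q‖ < 1) (hz : ‖z‖ ≤ 2) (m n : ℕ) :
    ‖(-1) ^ m * q ^ n * z‖ ≤ 2 := by
  rw [norm_mul, norm_mul, norm_pow, norm_pow, norm_neg, norm_one, one_pow, one_mul]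
  have : ‖q‖ ^ n ≤ 1 := pow_le_one₀ (norm_nonneg _) hq.le
  nlinarith [norm_nonneg z, norm_nonneg q]

lemma two_mul_choose_two (m : ℕ) : m ^ 2 = 2 * m.choose 2 + m := by
  induction m with
  | zero => rfl
  | succ m ih => rw [choose_succ_two]; linear_combination ih

/-- The first Rogers–Ramanujan identity. -/
theorem hasSum_rogersRamanujan {q : ℂ} (hq : ‖q‖ < 1) :
    HasSum (fun s : ℕ => q ^ (s ^ 2) / qPoch q q s)
      (qPochInf₃ (q ^ 2) (q ^ 3) (q ^ 5) (q ^ 5) / qPochInf q q) := by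
  have hn : ∀ k ≠ 0, ‖q ^ k‖ < 1 := fun k hk => by
    rw [norm_pow]; exact pow_lt_one₀ (norm_nonneg _) hq hk
  have hJ := hasSum_jacobiTerm (hn 2 (by simp)) (hn 3 (by simp))
  rw [show q ^ 2 * q ^ 3 = q ^ 5 by ring] at hJ
  have hl := (hJ.summable.comp_injective Sum.inl_injective).hasSum
  have hr := (hJ.summable.comp_injective Sum.inr_injective).hasSum
  have hlr := (hl.sum hr).unique hJ
  -- The negative indices start at `-1`; padding with a zero at `m = 0` pairs `m` with `-m`,
  -- matching the two summands of `1 + q^m` and the exceptional weight `1` at `m = 0`.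
  have hr' : HasSum (fun m : ℕ => if m = 0 then 0 else jacobiTerm (q ^ 2) (q ^ 3) (Sum.inr (m - 1)))
      (∑' m, (jacobiTerm (q ^ 2) (q ^ 3) ∘ Sum.inr) m) := by
    rw [← hasSum_nat_add_iff' 1]
    simpa [Function.comp_def] using hr
  have h := hasSum_of_sum_weight hq (w := pentWeight q) (e := 0)
    (T := qPochInf₃ (q ^ 2) (q ^ 3) (q ^ 5) (q ^ 5)) (fun m => ?_) (sum_pentWeight hq) ?_
  · simpa using h
  · rw [pentWeight]
    split_ifs
    · simp
    · refine norm_neg_one_pow_mul_pow_mul_le hq ((norm_add_le _ _).trans ?_) _ _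
      have : ‖q ^ m‖ ≤ 1 := by rw [norm_pow]; exact pow_le_one₀ (norm_nonneg _) hq.le
      rw [norm_one]; linarith
  · rw [← hlr]
    refine (hl.add hr').congr_fun fun m => ?_
    rcases m with _ | m
    · simp [pentWeight, jacobiTerm]
    · simp only [pentWeight, jacobiTerm, Nat.succ_ne_zero, if_false, Function.comp_apply,
        Sum.elim_inl, Sum.elim_inr, Nat.add_sub_cancel, zero_mul, add_zero]
      rw [two_mul_choose_two (m + 1)]
      generalize (m + 1).choose 2 = c
      rw [← pow_add, ← pow_mul, ← pow_mul, ← pow_mul]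
      ring

/-- The second Rogers–Ramanujan identity. -/
theorem hasSum_rogersRamanujan_odd {q : ℂ} (hq : ‖q‖ < 1) :
    HasSum (fun s : ℕ => q ^ (s ^ 2 + s) / qPoch q q s)
      (qPochInf₃ q (q ^ 4) (q ^ 5) (q ^ 5) / qPochInf q q) := by
  have hn : ∀ k ≠ 0, ‖q ^ k‖ < 1 := fun k hk => by
    rw [norm_pow]; exact pow_lt_one₀ (norm_nonneg _) hq hk
  -- With `q⁴` listed first, the indices `m` and `-(m + 1)` give the two terms of `1 - q^{2m+1}`, so
  -- no padding is needed.
  have hJ := hasSum_jacobiTerm (hn 4 (by simp)) hq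
  rw [show q ^ 4 * q = q ^ 5 by ring] at hJ
  have hl := (hJ.summable.comp_injective Sum.inl_injective).hasSum
  have hr := (hJ.summable.comp_injective Sum.inr_injective).hasSum
  have hlr := (hl.sum hr).unique hJ
  have h := hasSum_of_sum_weight hq (w := pentWeightOdd q) (e := 1)
    (T := qPochInf₃ q (q ^ 4) (q ^ 5) (q ^ 5)) (fun m => ?_) (sum_pentWeightOdd hq) ?_
  · simpa using h
  · refine norm_neg_one_pow_mul_pow_mul_le hq ((norm_sub_le _ _).trans ?_) _ _
    have : ‖q ^ (2 * m + 1)‖ ≤ 1 := by rw [norm_pow]; exact pow_le_one₀ (norm_nonneg _) hq.le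
    rw [norm_one]; linarith
  · have : qPochInf₃ q (q ^ 4) (q ^ 5) (q ^ 5) = qPochInf₃ (q ^ 4) q (q ^ 5) (q ^ 5) := by
      simp only [qPochInf₃]; ring
    rw [this, ← hlr]
    refine (hl.add hr).congr_fun fun m => ?_
    simp only [pentWeightOdd, jacobiTerm, Function.comp_apply, Sum.elim_inl, Sum.elim_inr]
    rw [two_mul_choose_two m, choose_succ_two]
    generalize m.choose 2 = c
    rw [← pow_succ, ← pow_mul, ← pow_mul, ← pow_mul]
    ring

/-! ### A convolution identity -/

/-- The coefficients of `1 / (x²; q²)_∞` as a power series in `x`. -/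
def evenCoeff (q : ℂ) (b : ℕ) : ℂ := if Even b then (qPoch (q ^ 2) (q ^ 2) (b / 2))⁻¹ else 0

lemma evenCoeff_add_two {q : ℂ} (hq : ‖q‖ < 1) (b : ℕ) :
    q ^ (b + 2) * evenCoeff q (b + 2) = evenCoeff q (b + 2) - evenCoeff q b := by
  rcases Nat.even_or_odd' b with ⟨k, rfl | rfl⟩
  · have h1 : Even (2 * k) := even_two_mul k
    have h2 : Even (2 * k + 2) := h1.add even_two
    have h3 : (2 * k + 2) / 2 = k + 1 := by omega
    have h4 : 2 * k / 2 = k := by omega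
    rw [evenCoeff, evenCoeff, if_pos h1, if_pos h2, h3, h4,
      qPoch_inv_eq (norm_sq_lt_one hq) k]
    ring
  · have h1 : ¬ Even (2 * k + 1) := by simp
    have h2 : ¬ Even (2 * k + 1 + 2) := by
      rw [Nat.even_add]; simp
    simp [evenCoeff, h1, h2]

open PowerSeries in
-- These are the coefficients of `(-x;q)_∞/(x²;q²)_∞ = 1/(x;q)_∞`. From `F(x) = (1 + x)F(qx)` and
-- `G(qx) = (1 - x²)G(x)`, the product `H = FG` satisfies `H(qx) = (1 - x)H(x)`, which determines
-- its coefficients from the constant term `1`.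
theorem sum_antidiagonal_evenCoeff {q : ℂ} (hq : ‖q‖ < 1) (n : ℕ) :
    ∑ p ∈ Finset.HasAntidiagonal.antidiagonal n, q ^ p.1.choose 2 / qPoch q q p.1 * evenCoeff q p.2 =
      (qPoch q q n)⁻¹ := by
  set F : PowerSeries ℂ := PowerSeries.mk fun j => q ^ j.choose 2 / qPoch q q j with hF
  set G : PowerSeries ℂ := PowerSeries.mk (evenCoeff q) with hG
  have h1 : F = (1 + X) * rescale q F := by
    ext j
    rcases j with _ | j
    · rw [add_mul, one_mul, map_add, coeff_zero_X_mul, coeff_rescale]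
      simp
    · rw [add_mul, one_mul, map_add, coeff_succ_X_mul]
      simp only [hF, coeff_rescale, coeff_mk]
      have h0 := qPoch_ne_zero hq hq j
      have h1 := one_sub_mul_pow_ne_zero hq hq j
      rw [qPoch_succ, choose_succ_two]
      field_simp
      ring
  have h2 : rescale q G = (1 - X ^ 2) * G := by
    ext j
    rcases j with _ | _ | j
    · simp [hG, sub_mul]
    · simp [hG, sub_mul, coeff_X_pow_mul', evenCoeff]
    · rw [sub_mul, one_mul, map_sub, add_assoc, coeff_X_pow_mul]
      simp only [hG, coeff_rescale, coeff_mk]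
      exact evenCoeff_add_two hq j
  have hX : (1 + X : PowerSeries ℂ) ≠ 0 := by
    intro h
    have := congrArg (coeff 0) h
    simp at this
  have h3 : rescale q (F * G) = (1 - X) * (F * G) := by
    apply mul_left_cancel₀ hX
    rw [map_mul, h2]
    linear_combination -((1 - X ^ 2) * G) * h1
  have h4 : ∀ n, coeff n (F * G) = (qPoch q q n)⁻¹ := by
    intro n
    induction n with
    | zero => simp [hF, hG, coeff_mul, evenCoeff]
    | succ n ih =>
      have h5 := congrArg (coeff (n + 1)) h3
      rw [coeff_rescale, sub_mul, one_mul, map_sub, coeff_succ_X_mul, ih] at h5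
      have h6 := qPoch_inv_eq hq n
      have hd : (1 - q ^ (n + 1)) ≠ 0 := by
        rw [pow_succ']; exact one_sub_mul_pow_ne_zero hq hq n
      apply mul_left_cancel₀ hd
      rw [← h6]
      linear_combination -h5
  rw [← h4 n, coeff_mul]
  simp [hF, hG]

/-- Summation over the pairs `(j, k)` according to the value of `j + 2 k`. -/
theorem hasSum_convolution {q : ℂ} (hq : ‖q‖ < 1) {φ : ℕ → ℂ} {a : ℂ}
    (hs : Summable fun p : ℕ × ℕ =>
      q ^ p.1.choose 2 / qPoch q q p.1 * (qPoch (q ^ 2) (q ^ 2) p.2)⁻¹ * φ (p.1 + 2 * p.2))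
    (ha : HasSum (fun n => (qPoch q q n)⁻¹ * φ n) a) :
    HasSum (fun p : ℕ × ℕ =>
      q ^ p.1.choose 2 / qPoch q q p.1 * (qPoch (q ^ 2) (q ^ 2) p.2)⁻¹ * φ (p.1 + 2 * p.2)) a := by
  set g : ℕ × ℕ → ℂ := fun p =>
    q ^ p.1.choose 2 / qPoch q q p.1 * evenCoeff q p.2 * φ (p.1 + p.2) with hg
  -- Replacing `k` by `b = 2k` adds only zero terms, those with `b` odd, and turns `j + 2k` into an
  -- antidiagonal index.
  have hinj : Function.Injective fun p : ℕ × ℕ => (p.1, 2 * p.2) := by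
    rintro ⟨a, b⟩ ⟨c, d⟩ h
    simp only [Prod.mk.injEq] at h ⊢
    omega
  have h1 : HasSum g (∑' p : ℕ × ℕ,
      q ^ p.1.choose 2 / qPoch q q p.1 * (qPoch (q ^ 2) (q ^ 2) p.2)⁻¹ * φ (p.1 + 2 * p.2)) := by
    rw [← hinj.hasSum_iff]
    · simpa [hg, evenCoeff, Function.comp_def] using hs.hasSum
    · rintro ⟨j, b⟩ hb
      have : ¬ Even b := fun ⟨k, hk⟩ => hb ⟨(j, k), by simp [hk, two_mul]⟩
      simp [hg, evenCoeff, this]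
  have h2 := hasSum_sum_antidiagonal h1
  have h3 : (fun n => ∑ p ∈ Finset.HasAntidiagonal.antidiagonal n, g p) = fun n => (qPoch q q n)⁻¹ * φ n := by
    funext n
    rw [← sum_antidiagonal_evenCoeff hq, Finset.sum_mul]
    refine Finset.sum_congr rfl fun p hp => ?_
    rw [hg, ← Finset.HasAntidiagonal.mem_antidiagonal.1 hp]
  rw [h3] at h2
  rw [ha.unique h2]
  exact hs.hasSum

/-! ### Triple sums of index `(1, 1, 2)`

The suffix of a theorem `hasSum_index112_*` lists the entries of the matrix row by row. -/

/-- The terms of a triple sum of index `(1, 1, 2)` with exponents given as natural numbers. -/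
def index112Term (q : ℂ) (N : ℕ → ℕ → ℕ → ℕ) (n : ℕ × ℕ × ℕ) : ℂ :=
  q ^ N n.1 n.2.1 n.2.2 / (qPoch q q n.1 * qPoch q q n.2.1 * qPoch (q ^ 2) (q ^ 2) n.2.2)

lemma hasIndex112Sum_of_natCast {q : ℂ} {E : ℂ → ℂ → ℂ → ℂ} {N : ℕ → ℕ → ℕ → ℕ} {P : ℂ}
    (h : HasSum (index112Term q N) P) (hE : ∀ i j k : ℕ, E i j k = (N i j k : ℂ)) :
    HasIndex112Sum q E P := by
  refine h.congr_fun fun n => ?_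
  rw [index112Term, hE, Complex.cpow_natCast]

lemma summable_index112Term {q : ℂ} (hq : ‖q‖ < 1) {N : ℕ → ℕ → ℕ → ℕ}
    (hN : ∀ i j k, i + (j + k) ≤ N i j k) : Summable (index112Term q N) := by
  obtain ⟨C, hC1, hC⟩ := exists_norm_qPoch_inv_le hq
  obtain ⟨D, hD1, hD⟩ := exists_norm_qPoch_inv_le (norm_sq_lt_one hq)
  have hg := summable_geometric_of_lt_one (norm_nonneg q) hq
  have hg2 := hg.mul_of_nonneg hg (fun _ => by positivity) (fun _ => by positivity)
  have hg3 := hg.mul_of_nonneg hg2 (fun _ => by positivity) (fun _ => by positivity)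
  refine Summable.of_norm_bounded (hg3.mul_right (C * C * D)) fun n => ?_
  rw [index112Term, div_eq_mul_inv, mul_inv, mul_inv, norm_mul, norm_mul, norm_mul, norm_pow,
    ← pow_add, ← pow_add]
  have h : ‖q‖ ^ N n.1 n.2.1 n.2.2 ≤ ‖q‖ ^ (n.1 + (n.2.1 + n.2.2)) :=
    pow_le_pow_of_le_one (norm_nonneg _) hq.le (hN _ _ _)
  gcongr
  · exact hC _
  · exact hC _
  · exact hD _

/-- Summability of the fibre sums comes for free and is handed to `h₂`, since the next rearrangement
needs it. -/
lemma hasSum_of_fiberwise_snd {α β : Type*} {f : α × β → ℂ} {g : β → ℂ} {a : ℂ}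
    (hf : Summable f) (h₁ : ∀ b, HasSum (fun c => f (c, b)) (g b))
    (h₂ : Summable g → HasSum g a) : HasSum f a := by
  have hs : Summable (f ∘ Equiv.prodComm β α) := (Equiv.prodComm β α).summable_iff.2 hf
  exact (Equiv.prodComm β α).hasSum_iff.1
    (hasSum_of_fiberwise hs h₁ (h₂ (hs.hasSum.prod_fiberwise h₁).summable))

/-- Euler's identity at `x = q^{j+1}`, with the first `j` factors of `(-q;q)_∞` divided out. -/
lemma hasSum_euler_shift {q : ℂ} (hq : ‖q‖ < 1) (j : ℕ) :
    HasSum (fun i : ℕ => q ^ (i.choose 2 + i + i * j) / qPoch q q i)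
      (qPochInf (-q) q / qPoch (-q) q j) := by
  have hx : ‖q * q ^ j‖ < 1 := by
    rw [← pow_succ', norm_pow]; exact pow_lt_one₀ (norm_nonneg _) hq (by simp)
  have h := hasSum_euler hx hq
  have h0 := qPoch_ne_zero (a := -q) (by simpa using hq) hq j
  rw [← qPoch_mul_qPochInf (-q) hq j, mul_div_cancel_left₀ _ h0, neg_mul]
  refine h.congr_fun fun i => ?_
  rw [← pow_succ', ← pow_mul, ← pow_add]
  congr 2
  ring

lemma div_qPochInf_eq {q T : ℂ} (hq : ‖q‖ < 1) :
    qPochInf (-q) q * (T / qPochInf (q ^ 2) (q ^ 2)) = T / qPochInf q q := by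
  have h0 := qPochInf_ne_zero hq hq
  have h1 : qPochInf (-q) q ≠ 0 := qPochInf_ne_zero (by simpa using hq) hq
  rw [← qPochInf_mul_qPochInf_neg hq]
  field_simp

section

variable {q T : ℂ} {e : ℕ}

/-- Summing over the first variable by Euler leaves the Rogers–Ramanujan sum in base `q²`. -/
lemma hasSum_double (hq : ‖q‖ < 1)
    (hT : HasSum (fun s : ℕ => (q ^ 2) ^ (s ^ 2 + e * s) / qPoch (q ^ 2) (q ^ 2) s)
      (T / qPochInf (q ^ 2) (q ^ 2)))
    (hs : Summable fun p : ℕ × ℕ => q ^ (p.1.choose 2 + p.1 + p.1 * p.2 + 2 * p.2 ^ 2 + 2 * e * p.2) /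
      (qPoch q q p.1 * qPoch q q p.2)) :
    HasSum (fun p : ℕ × ℕ => q ^ (p.1.choose 2 + p.1 + p.1 * p.2 + 2 * p.2 ^ 2 + 2 * e * p.2) /
      (qPoch q q p.1 * qPoch q q p.2)) (T / qPochInf q q) := by
  rw [← div_qPochInf_eq hq]
  refine hasSum_of_fiberwise_snd hs (fun k => ?_) fun _ => hT.mul_left (qPochInf (-q) q)
  have h2 := qPoch_ne_zero hq hq k
  have h3 := qPoch_ne_zero (a := -q) (by simpa using hq) hq k
  have h := (hasSum_euler_shift hq k).mul_right
    (q ^ (2 * k ^ 2 + 2 * e * k) / qPoch q q k)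
  have e1 : qPochInf (-q) q * ((q ^ 2) ^ (k ^ 2 + e * k) / qPoch (q ^ 2) (q ^ 2) k) =
      qPochInf (-q) q / qPoch (-q) q k * (q ^ (2 * k ^ 2 + 2 * e * k) / qPoch q q k) := by
    rw [← qPoch_mul_qPoch_neg, ← pow_mul]
    field_simp
    ring
  rw [e1]
  refine h.congr_fun fun j => ?_
  rw [div_mul_div_comm, ← pow_add, add_assoc _ (2 * k ^ 2)]

/-- The double sum remaining after summation over `i`. -/
lemma hasSum_index112Term_of_euler (hq : ‖q‖ < 1) {M : ℕ × ℕ → ℕ} {m : ℕ × ℕ → ℕ} {P : ℂ}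
    (hs : Summable (index112Term q fun i j k => i.choose 2 + i + i * m (j, k) + M (j, k)))
    (h : (Summable fun p : ℕ × ℕ => qPochInf (-q) q / qPoch (-q) q (m p) *
        (q ^ M p / (qPoch q q p.1 * qPoch (q ^ 2) (q ^ 2) p.2))) →
      HasSum (fun p : ℕ × ℕ => qPochInf (-q) q / qPoch (-q) q (m p) *
        (q ^ M p / (qPoch q q p.1 * qPoch (q ^ 2) (q ^ 2) p.2))) P) :
    HasSum (index112Term q fun i j k => i.choose 2 + i + i * m (j, k) + M (j, k)) P := by
  refine hasSum_of_fiberwise_snd hs (fun p => ?_) h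
  refine ((hasSum_euler_shift hq (m p)).mul_right _).congr_fun fun i => ?_
  rw [index112Term, div_mul_div_comm, ← pow_add, mul_assoc]

/-- After summation over `i` every exponent is even and `(q;q)_j (-q;q)_j = (q²;q²)_j`, so what
remains is the double sum of `hasSum_double` in base `q²`. -/
theorem hasSum_index112_110_121_024 (hq : ‖q‖ < 1)
    (hT : HasSum (fun s : ℕ => (q ^ 4) ^ (s ^ 2 + e * s) / qPoch (q ^ 4) (q ^ 4) s)
      (T / qPochInf (q ^ 4) (q ^ 4))) :
    HasSum (index112Term q fun i j k =>
      i.choose 2 + i + i * j + (j ^ 2 + j + 2 * j * k + 4 * k ^ 2 + 4 * e * k))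
      (T / qPochInf q q) := by
  refine hasSum_index112Term_of_euler hq (m := fun p => p.1)
    (M := fun p => p.1 ^ 2 + p.1 + 2 * p.1 * p.2 + 4 * p.2 ^ 2 + 4 * e * p.2)
    (summable_index112Term hq fun i j k => ?_) fun hs => ?_
  · nlinarith [Nat.zero_le (i.choose 2), Nat.zero_le (i * j), Nat.zero_le (j * k),
      Nat.zero_le (e * k), Nat.le_self_pow two_ne_zero k, Nat.zero_le (j ^ 2)]
  have hterm : ∀ p : ℕ × ℕ, qPochInf (-q) q / qPoch (-q) q p.1 *
      (q ^ (p.1 ^ 2 + p.1 + 2 * p.1 * p.2 + 4 * p.2 ^ 2 + 4 * e * p.2) /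
        (qPoch q q p.1 * qPoch (q ^ 2) (q ^ 2) p.2)) =
      qPochInf (-q) q * ((q ^ 2) ^ (p.1.choose 2 + p.1 + p.1 * p.2 + 2 * p.2 ^ 2 + 2 * e * p.2) /
      (qPoch (q ^ 2) (q ^ 2) p.1 * qPoch (q ^ 2) (q ^ 2) p.2)) := fun p => by
    have h : p.1 ^ 2 + p.1 + 2 * p.1 * p.2 + 4 * p.2 ^ 2 + 4 * e * p.2 =
        2 * (p.1.choose 2 + p.1 + p.1 * p.2 + 2 * p.2 ^ 2 + 2 * e * p.2) := by
      rw [two_mul_choose_two p.1]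
      ring
    rw [← qPoch_mul_qPoch_neg q p.1, ← pow_mul, h]
    simp only [div_eq_mul_inv, mul_inv]
    ring
  simp only [hterm] at hs ⊢
  rw [← div_qPochInf_eq hq]
  have hne : qPochInf (-q) q ≠ 0 := qPochInf_ne_zero (by simpa using hq) hq
  refine (hasSum_double (norm_sq_lt_one hq) ?_ ((summable_mul_left_iff hne).1 hs)).mul_left _
  simpa only [← pow_mul] using hT

/-- After summation over `i` the same double sum in base `q²` appears, now with `k` as the variable
of the second Euler step. -/
theorem hasSum_index112_110_181_021 (hq : ‖q‖ < 1)
    (hT : HasSum (fun s : ℕ => (q ^ 4) ^ (s ^ 2 + e * s) / qPoch (q ^ 4) (q ^ 4) s)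
      (T / qPochInf (q ^ 4) (q ^ 4))) :
    HasSum (index112Term q fun i j k =>
      i.choose 2 + i + i * j + (k ^ 2 + k + 2 * k * j + 4 * j ^ 2 + 4 * e * j))
      (T / qPochInf q q) := by
  refine hasSum_index112Term_of_euler hq (m := fun p => p.1)
    (M := fun p => p.2 ^ 2 + p.2 + 2 * p.2 * p.1 + 4 * p.1 ^ 2 + 4 * e * p.1)
    (summable_index112Term hq fun i j k => ?_) fun hs => ?_
  · nlinarith [Nat.zero_le (i.choose 2), Nat.zero_le (i * j), Nat.zero_le (k * j),
      Nat.zero_le (e * j), Nat.le_self_pow two_ne_zero j, Nat.zero_le (k ^ 2)]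
  have hterm : ∀ p : ℕ × ℕ, qPochInf (-q) q / qPoch (-q) q p.1 *
      (q ^ (p.2 ^ 2 + p.2 + 2 * p.2 * p.1 + 4 * p.1 ^ 2 + 4 * e * p.1) /
        (qPoch q q p.1 * qPoch (q ^ 2) (q ^ 2) p.2)) =
      qPochInf (-q) q * ((q ^ 2) ^ (p.2.choose 2 + p.2 + p.2 * p.1 + 2 * p.1 ^ 2 + 2 * e * p.1) /
      (qPoch (q ^ 2) (q ^ 2) p.2 * qPoch (q ^ 2) (q ^ 2) p.1)) := fun p => by
    have h : p.2 ^ 2 + p.2 + 2 * p.2 * p.1 + 4 * p.1 ^ 2 + 4 * e * p.1 =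
        2 * (p.2.choose 2 + p.2 + p.2 * p.1 + 2 * p.1 ^ 2 + 2 * e * p.1) := by
      rw [two_mul_choose_two p.2]
      ring
    rw [← qPoch_mul_qPoch_neg q p.1, ← pow_mul, h]
    simp only [div_eq_mul_inv, mul_inv]
    ring
  simp only [hterm] at hs ⊢
  rw [← div_qPochInf_eq hq]
  have hne : qPochInf (-q) q ≠ 0 := qPochInf_ne_zero (by simpa using hq) hq
  refine HasSum.mul_left _ ?_
  rw [← (Equiv.prodComm ℕ ℕ).hasSum_iff]
  refine hasSum_double (norm_sq_lt_one hq) ?_ ?_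
  · simpa only [← pow_mul] using hT
  · exact (Equiv.prodComm ℕ ℕ).summable_iff.2 ((summable_mul_left_iff hne).1 hs)

/-- Apart from `q^{j(j-1)/2}`, the sum over `i` and the remaining exponent depend only on `n = j +
2k`, so the convolution identity merges `j` and `k`. -/
theorem hasSum_index112_111_154_288 (hq : ‖q‖ < 1)
    (hT : HasSum (fun s : ℕ => (q ^ 2) ^ (s ^ 2 + e * s) / qPoch (q ^ 2) (q ^ 2) s)
      (T / qPochInf (q ^ 2) (q ^ 2))) :
    HasSum (index112Term q fun i j k => i.choose 2 + i + i * (j + 2 * k) +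
      (j.choose 2 + 2 * (j + 2 * k) ^ 2 + 2 * e * (j + 2 * k))) (T / qPochInf q q) := by
  refine hasSum_index112Term_of_euler hq (m := fun p => p.1 + 2 * p.2)
    (M := fun p => p.1.choose 2 + 2 * (p.1 + 2 * p.2) ^ 2 + 2 * e * (p.1 + 2 * p.2))
    (summable_index112Term hq fun i j k => ?_) fun hs => ?_
  · nlinarith [Nat.zero_le (i.choose 2), Nat.zero_le (i * (j + 2 * k)), Nat.zero_le (j.choose 2),
      Nat.zero_le (e * (j + 2 * k)), Nat.le_self_pow two_ne_zero (j + 2 * k)]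
  obtain ⟨φ, hφ⟩ : ∃ φ : ℕ → ℂ, ∀ n, φ n =
    qPochInf (-q) q / qPoch (-q) q n * q ^ (2 * n ^ 2 + 2 * e * n) := ⟨_, fun _ => rfl⟩
  have hterm : ∀ p : ℕ × ℕ, qPochInf (-q) q / qPoch (-q) q (p.1 + 2 * p.2) *
      (q ^ (p.1.choose 2 + 2 * (p.1 + 2 * p.2) ^ 2 + 2 * e * (p.1 + 2 * p.2)) /
        (qPoch q q p.1 * qPoch (q ^ 2) (q ^ 2) p.2)) =
      q ^ p.1.choose 2 / qPoch q q p.1 * (qPoch (q ^ 2) (q ^ 2) p.2)⁻¹ *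
        φ (p.1 + 2 * p.2) := fun p => by
    simp only [hφ]
    simp only [pow_add, div_eq_mul_inv, mul_inv]
    ring
  simp only [hterm] at hs ⊢
  refine hasSum_convolution hq hs ?_
  rw [← div_qPochInf_eq hq]
  refine (hT.mul_left (qPochInf (-q) q)).congr_fun fun n => ?_
  rw [← qPoch_mul_qPoch_neg, ← pow_mul, hφ]
  simp only [div_eq_mul_inv, mul_inv]
  ring

theorem hasSum_index112_211_141_222 (hq : ‖q‖ < 1)
    (hT : HasSum (fun s : ℕ => (q ^ 2) ^ (s ^ 2 + e * s) / qPoch (q ^ 2) (q ^ 2) s)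
      (T / qPochInf (q ^ 2) (q ^ 2))) :
    HasSum (index112Term q fun i j k =>
      i ^ 2 + 2 * j ^ 2 + 2 * k ^ 2 + i * j + 2 * i * k + 2 * j * k + k + 2 * e * j)
      (T / qPochInf q q) := by
  set f := index112Term q fun i j k =>
      i ^ 2 + 2 * j ^ 2 + 2 * k ^ 2 + i * j + 2 * i * k + 2 * j * k + k + 2 * e * j with hf
  have hs : Summable f := summable_index112Term hq fun i j k => by
    nlinarith [Nat.zero_le (i * j), Nat.zero_le (j * k), Nat.zero_le (i * k), Nat.zero_le (e * j),
      Nat.le_self_pow two_ne_zero i, Nat.le_self_pow two_ne_zero j]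
  -- Here `j` is held fixed: apart from `q^{i(i-1)/2}` the exponent depends on `i, k` only through
  -- `i + 2k`. The convolution therefore comes first, and Euler's identity is applied to the merged
  -- variable.
  let σ : ℕ × ℕ × ℕ ≃ ℕ × ℕ × ℕ :=
    { toFun := fun p => (p.2.1, p.1, p.2.2)
      invFun := fun p => (p.2.1, p.1, p.2.2)
      left_inv := fun _ => rfl
      right_inv := fun _ => rfl }
  have hsσ : Summable (f ∘ σ) := σ.summable_iff.2 hs
  rw [← σ.hasSum_iff, ← div_qPochInf_eq hq]
  refine hasSum_of_fiberwise hsσ (g := fun j => qPochInf (-q) q *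
    ((q ^ 2) ^ (j ^ 2 + e * j) / qPoch (q ^ 2) (q ^ 2) j)) (fun j => ?_)
    (hT.mul_left (qPochInf (-q) q))
  obtain ⟨φ, hφ⟩ : ∃ φ : ℕ → ℂ, ∀ n, φ n =
    q ^ (n.choose 2 + n + n * j) * (q ^ (2 * j ^ 2 + 2 * e * j) / qPoch q q j) :=
    ⟨_, fun _ => rfl⟩
  have hterm : (fun p : ℕ × ℕ => (f ∘ σ) (j, p)) = fun p =>
      q ^ p.1.choose 2 / qPoch q q p.1 * (qPoch (q ^ 2) (q ^ 2) p.2)⁻¹ *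
        φ (p.1 + 2 * p.2) := by
    funext ⟨i, k⟩
    have h1 := two_mul_choose_two i
    have h2 := two_mul_choose_two (i + 2 * k)
    have h3 : i ^ 2 + 2 * j ^ 2 + 2 * k ^ 2 + i * j + 2 * i * k + 2 * j * k + k + 2 * e * j =
        i.choose 2 + ((i + 2 * k).choose 2 + (i + 2 * k) + (i + 2 * k) * j) +
          (2 * j ^ 2 + 2 * e * j) := by
      nlinarith
    simp only [hf, Function.comp_apply, σ, Equiv.coe_fn_mk, index112Term]
    rw [h3, hφ, pow_add, pow_add]
    simp only [div_eq_mul_inv, mul_inv]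
    ring
  have hsj : Summable fun p : ℕ × ℕ => (f ∘ σ) (j, p) := hsσ.prod_factor j
  rw [hterm] at hsj ⊢
  refine hasSum_convolution hq hsj ?_
  have h := (hasSum_euler_shift hq j).mul_right (q ^ (2 * j ^ 2 + 2 * e * j) / qPoch q q j)
  have e1 : qPochInf (-q) q * ((q ^ 2) ^ (j ^ 2 + e * j) / qPoch (q ^ 2) (q ^ 2) j) =
      qPochInf (-q) q / qPoch (-q) q j * (q ^ (2 * j ^ 2 + 2 * e * j) / qPoch q q j) := by
    rw [← qPoch_mul_qPoch_neg, ← pow_mul]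
    simp only [div_eq_mul_inv, mul_inv]
    ring
  rw [e1]
  refine h.congr_fun fun n => ?_
  rw [hφ]
  simp only [div_eq_mul_inv]
  ring

end

/-! ### Theta functions with rational characteristics -/

/-- The theta function `∑ exp(π i (n + r)² τ + 2 π i n s)` with characteristics `r`, `s`. -/
def thetaChar (r s τ : ℂ) : ℂ :=
  Complex.exp (Real.pi * Complex.I * r ^ 2 * τ) * jacobiTheta₂ (r * τ + s) τ

/-- `n² ≡ n` modulo 2. -/
lemma jacobiTheta₂_add_one_right (z τ : ℂ) :
    jacobiTheta₂ z (τ + 1) = jacobiTheta₂ (z + 1 / 2) τ := by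
  refine tsum_congr fun n => ?_
  rw [jacobiTheta₂_term, jacobiTheta₂_term, Complex.exp_eq_exp_iff_exists_int]
  obtain ⟨k, hk⟩ : Even (n * (n - 1)) := Int.even_mul_pred_self n
  refine ⟨k, ?_⟩
  have hk' : (n : ℂ) * (n - 1) = k + k := by exact_mod_cast hk
  linear_combination Real.pi * Complex.I * hk'

lemma thetaChar_add_one (r s τ : ℂ) :
    thetaChar r s (τ + 1) =
      Complex.exp (Real.pi * Complex.I * r ^ 2) * thetaChar r (s + r + 1 / 2) τ := by
  rw [thetaChar, thetaChar, jacobiTheta₂_add_one_right, ← mul_assoc, ← Complex.exp_add]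
  congr 2 <;> ring

lemma thetaChar_neg_inv (r s : ℂ) {τ : ℂ} (hτ : 0 < τ.im) :
    thetaChar r s (-1 / τ) = (-Complex.I * τ) ^ (1 / 2 : ℂ) *
      Complex.exp (-2 * Real.pi * Complex.I * (r * s)) * thetaChar s (-r) τ := by
  have h0 : τ ≠ 0 := by rintro rfl; simp at hτ
  have h1 : (-Complex.I * τ) ^ (1 / 2 : ℂ) ≠ 0 := by
    rw [Complex.cpow_ne_zero_iff]
    left
    simp [h0]
  have h := jacobiTheta₂_functional_equation (s * τ + -r) τ
  rw [thetaChar, thetaChar, h, show (s * τ + -r) / τ = r * (-1 / τ) + s by field_simp; ring]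
  have e : Complex.exp (Real.pi * Complex.I * r ^ 2 * (-1 / τ)) =
      Complex.exp (-2 * Real.pi * Complex.I * (r * s)) *
        Complex.exp (Real.pi * Complex.I * s ^ 2 * τ) *
        Complex.exp (-Real.pi * Complex.I * (s * τ + -r) ^ 2 / τ) := by
    rw [← Complex.exp_add, ← Complex.exp_add]
    congr 1
    field_simp
    ring
  rw [e]
  field_simp

lemma thetaChar_add_one_left (r s τ : ℂ) :
    thetaChar (r + 1) s τ = Complex.exp (-2 * Real.pi * Complex.I * s) * thetaChar r s τ := by
  rw [thetaChar, thetaChar, show (r + 1) * τ + s = (r * τ + s) + τ by ring,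
    jacobiTheta₂_add_left', ← mul_assoc, ← mul_assoc, ← Complex.exp_add, ← Complex.exp_add]
  congr 2
  ring

lemma thetaChar_add_one_middle (r s τ : ℂ) : thetaChar r (s + 1) τ = thetaChar r s τ := by
  rw [thetaChar, thetaChar, ← add_assoc, jacobiTheta₂_add_left]

/-- Completing the square, the `n`-th term has norm `exp(-π (n + r)² Im τ)`, which decreases in `Im
τ`. -/
lemma norm_thetaChar_le (r s : ℝ) {c : ℝ} (hc : 0 < c) :
    ∃ B : ℝ, ∀ τ : ℂ, c ≤ τ.im → ‖thetaChar r s τ‖ ≤ B := by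
  have hs : Summable fun n : ℤ => Real.exp (-Real.pi * (n + r) ^ 2 * c) := by
    have h := ((summable_jacobiTheta₂_term_iff (r * (c * Complex.I)) (c * Complex.I)).2
      (by simpa using hc)).norm.mul_left (Real.exp (-Real.pi * r ^ 2 * c))
    refine h.congr fun n => ?_
    rw [norm_jacobiTheta₂_term, ← Real.exp_add]
    congr 1
    simp
    ring
  refine ⟨∑' n : ℤ, Real.exp (-Real.pi * (n + r) ^ 2 * c), fun τ hτ => ?_⟩
  rw [thetaChar, jacobiTheta₂, ← tsum_mul_left]
  refine tsum_of_norm_bounded hs.hasSum fun n => ?_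
  rw [norm_mul, norm_jacobiTheta₂_term, Complex.norm_exp, ← Real.exp_add]
  apply Real.exp_le_exp.2
  have h1 : (Real.pi * Complex.I * (r : ℂ) ^ 2 * τ).re = -Real.pi * r ^ 2 * τ.im := by
    rw [show Real.pi * Complex.I * (r : ℂ) ^ 2 * τ = ((Real.pi * r ^ 2 : ℝ) : ℂ) * (Complex.I * τ) by
      push_cast; ring, Complex.re_ofReal_mul]
    simp
  have h2 : ((r : ℂ) * τ + s).im = r * τ.im := by simp
  rw [h1, h2]
  have h3 : 0 ≤ Real.pi * ((n : ℝ) + r) ^ 2 * (τ.im - c) :=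
    mul_nonneg (by positivity) (sub_nonneg.2 hτ)
  linarith

/-- A power of a theta function with characteristics in `(1 / 2l) ℤ`, of weight `12 (2l)²`. -/
def thetaPow (l : ℕ) (a b : ℤ) (τ : ℂ) : ℂ :=
  thetaChar ((a : ℂ) / (2 * l)) ((b : ℂ) / (2 * l)) τ ^ (24 * (2 * l) ^ 2)

lemma exp_pow_eq_one {x : ℂ} {n : ℕ} (k : ℤ) (h : n * x = k * (2 * Real.pi * Complex.I)) :
    Complex.exp x ^ n = 1 := by
  rw [← Complex.exp_nat_mul, Complex.exp_eq_one_iff]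
  exact ⟨k, h⟩

section

variable {l : ℕ} (hl : l ≠ 0)
include hl

/-- The exponent `24 (2l)²` turns every root of unity in the transformation laws into `1`, so `S`
and `T` merely move the pair `(a, b)`, which matters only modulo `2l`. It also matches `Δ ^ (2l)² =
η ^ (24 (2l)²)`. -/
lemma thetaPow_add_one (a b : ℤ) (τ : ℂ) :
    thetaPow l a b (τ + 1) = thetaPow l a (b + a + l) τ := by
  have hl' : (l : ℂ) ≠ 0 := by exact_mod_cast hl
  rw [thetaPow, thetaPow, thetaChar_add_one, mul_pow, exp_pow_eq_one (12 * a ^ 2), one_mul]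
  · congr 2
    push_cast
    field_simp
  · push_cast
    field_simp
    ring

lemma thetaPow_neg_inv (a b : ℤ) {τ : ℂ} (hτ : 0 < τ.im) :
    thetaPow l a b (-1 / τ) = τ ^ (12 * (2 * l) ^ 2) * thetaPow l b (-a) τ := by
  have hl' : (l : ℂ) ≠ 0 := by exact_mod_cast hl
  have h1 : ((-Complex.I * τ) ^ (1 / 2 : ℂ)) ^ (24 * (2 * l) ^ 2) = τ ^ (12 * (2 * l) ^ 2) := by
    rw [show 24 * (2 * l) ^ 2 = 2 * (12 * (2 * l) ^ 2) by ring, pow_mul, ← Complex.cpow_nat_mul]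
    have h2 : (-Complex.I) ^ 12 = 1 := by
      rw [show 12 = 4 * 3 from rfl, pow_mul, Even.neg_pow (by decide), Complex.I_pow_four, one_pow]
    rw [show ((2 : ℕ) : ℂ) * (1 / 2) = 1 by norm_num, Complex.cpow_one, mul_pow,
      pow_mul (-Complex.I), h2, one_pow, one_mul]
  rw [thetaPow, thetaPow, thetaChar_neg_inv _ _ hτ, mul_pow, mul_pow, h1,
    exp_pow_eq_one (-24 * (a * b)), mul_one]
  · congr 3
    push_cast
    ring
  · push_cast
    field_simp

lemma thetaPow_periodic_left (b : ℤ) (τ : ℂ) :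
    Function.Periodic (fun a => thetaPow l a b τ) (2 * l : ℕ) := by
  intro a
  have hl' : (l : ℂ) ≠ 0 := by exact_mod_cast hl
  simp only [thetaPow]
  have e : ((a + (2 * l : ℕ) : ℤ) : ℂ) / (2 * l) = (a : ℂ) / (2 * l) + 1 := by
    push_cast; field_simp
  rw [e, thetaChar_add_one_left, mul_pow, exp_pow_eq_one (-24 * (2 * l) * b), one_mul]
  push_cast
  field_simp

lemma thetaPow_periodic_right (a : ℤ) (τ : ℂ) :
    Function.Periodic (fun b => thetaPow l a b τ) (2 * l : ℕ) := by
  intro b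
  have hl' : (l : ℂ) ≠ 0 := by exact_mod_cast hl
  simp only [thetaPow]
  have e : ((b + (2 * l : ℕ) : ℤ) : ℂ) / (2 * l) = (b : ℂ) / (2 * l) + 1 := by
    push_cast; field_simp
  rw [e, thetaChar_add_one_middle]

end

lemma finite_range_of_periodic {α : Type*} {f : ℤ → ℤ → α} {L : ℕ} (hL : L ≠ 0)
    (h₁ : ∀ b, Function.Periodic (fun a => f a b) L) (h₂ : ∀ a, Function.Periodic (f a) L) :
    (Set.range fun p : ℤ × ℤ => f p.1 p.2).Finite := by
  have hmod : ∀ {g : ℤ → α}, Function.Periodic g L → ∀ a, g (a % L) = g a := fun {g} hg a => by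
    conv_rhs => rw [← Int.emod_add_mul_ediv a L, mul_comm]
    exact (hg.int_mul (a / L) (a % L)).symm
  refine ((((Set.finite_Ico (0 : ℤ) L).prod (Set.finite_Ico (0 : ℤ) L))).image
    (fun p : ℤ × ℤ => f p.1 p.2)).subset ?_
  rintro _ ⟨⟨a, b⟩, rfl⟩
  have hL' : (0 : ℤ) < L := by exact_mod_cast Nat.pos_of_ne_zero hL
  refine ⟨(a % L, b % L), ⟨⟨Int.emod_nonneg _ hL'.ne', Int.emod_lt_of_pos _ hL'⟩,
    ⟨Int.emod_nonneg _ hL'.ne', Int.emod_lt_of_pos _ hL'⟩⟩, ?_⟩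
  simp only
  rw [hmod (h₂ _), hmod (h₁ b)]

/-! ### The action of the modular group -/

lemma coe_SL_smul (γ : SL(2, ℤ)) (τ : ℍ) :
    ((γ • τ : ℍ) : ℂ) = ((γ 0 0 : ℂ) * τ + γ 0 1) / ((γ 1 0 : ℂ) * τ + γ 1 1) := by
  rw [UpperHalfPlane.coe_specialLinearGroup_apply]
  simp

lemma denom_SL_ne_zero (γ : SL(2, ℤ)) (τ : ℍ) : (γ 1 0 : ℂ) * τ + γ 1 1 ≠ 0 := by
  have := UpperHalfPlane.denom_ne_zero (γ : GL (Fin 2) ℝ) τ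
  rwa [ModularGroup.denom_apply] at this

lemma discriminant_smul (γ : SL(2, ℤ)) (τ : ℍ) :
    ModularForm.discriminant (γ • τ) =
      ((γ 1 0 : ℂ) * τ + γ 1 1) ^ 12 * ModularForm.discriminant τ := by
  have hγ : (γ : GL (Fin 2) ℝ) ∈ 𝒮ℒ := ⟨γ, rfl⟩
  have h := SlashInvariantForm.slash_action_eqn'' CuspForm.discriminant hγ τ
  rw [ModularGroup.denom_apply] at h
  simpa using h

/-- The weight zero quotient of a power of a theta function by a power of `Δ`. -/
def thetaQuot (l : ℕ) (a b : ℤ) (τ : ℍ) : ℂ :=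
  thetaPow l a b τ / ModularForm.discriminant τ ^ (2 * l) ^ 2

lemma thetaQuot_T_smul {l : ℕ} (hl : l ≠ 0) (a b : ℤ) (τ : ℍ) :
    thetaQuot l a b (ModularGroup.T • τ) = thetaQuot l a (b + a + l) τ := by
  rw [thetaQuot, thetaQuot, discriminant_smul]
  have : ((ModularGroup.T • τ : ℍ) : ℂ) = τ + 1 := by
    rw [coe_SL_smul]; simp [ModularGroup.T]
  rw [this, thetaPow_add_one hl]
  simp [ModularGroup.T]

lemma thetaQuot_S_smul {l : ℕ} (hl : l ≠ 0) (a b : ℤ) (τ : ℍ) :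
    thetaQuot l a b (ModularGroup.S • τ) = thetaQuot l b (-a) τ := by
  rw [thetaQuot, thetaQuot, discriminant_smul]
  have h0 := τ.ne_zero
  have : ((ModularGroup.S • τ : ℍ) : ℂ) = -1 / τ := by
    rw [coe_SL_smul]; simp [ModularGroup.S]
  rw [this, thetaPow_neg_inv hl _ _ τ.im_pos]
  have hd := ModularForm.discriminant_ne_zero τ
  simp only [ModularGroup.S, Matrix.SpecialLinearGroup.coe_mk, Matrix.of_apply, Matrix.cons_val',
    Matrix.cons_val_zero, Matrix.cons_val_one, Int.cast_one, one_mul, Int.cast_zero, add_zero,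
    mul_pow, ← pow_mul]
  field_simp

/-- In weight zero no automorphy factor has to be tracked through products of generators. Inverses
are carried along so that the induction over the generated subgroup closes. -/
lemma exists_thetaQuot_smul {l : ℕ} (hl : l ≠ 0) (γ : SL(2, ℤ)) :
    ∀ a b : ℤ, ∃ a' b' : ℤ, ∀ τ : ℍ, thetaQuot l a b (γ • τ) = thetaQuot l a' b' τ := by
  suffices h : (∀ a b : ℤ, ∃ a' b' : ℤ, ∀ τ : ℍ, thetaQuot l a b (γ • τ) = thetaQuot l a' b' τ) ∧
      ∀ a b : ℤ, ∃ a' b' : ℤ, ∀ τ : ℍ, thetaQuot l a b (γ⁻¹ • τ) = thetaQuot l a' b' τ from h.1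
  have hγ : γ ∈ Subgroup.closure {ModularGroup.S, ModularGroup.T} := by
    simp [SpecialLinearGroup.SL2Z_generators]
  induction hγ using Subgroup.closure_induction with
  | mem x hx =>
    rcases hx with rfl | rfl
    · refine ⟨fun a b => ⟨_, _, thetaQuot_S_smul hl a b⟩, fun a b => ⟨-b, a, fun τ => ?_⟩⟩
      have h := thetaQuot_S_smul hl (-b) a (ModularGroup.S⁻¹ • τ)
      rw [smul_inv_smul, neg_neg] at h
      exact h.symm
    · refine ⟨fun a b => ⟨_, _, thetaQuot_T_smul hl a b⟩, fun a b => ⟨a, b - a - l, fun τ => ?_⟩⟩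
      have h := thetaQuot_T_smul hl a (b - a - l) (ModularGroup.T⁻¹ • τ)
      rw [smul_inv_smul, show b - a - l + a + l = b by ring] at h
      exact h.symm
  | one => exact ⟨fun a b => ⟨a, b, by simp⟩, fun a b => ⟨a, b, by simp⟩⟩
  | mul x y _ _ hx hy =>
    refine ⟨fun a b => ?_, fun a b => ?_⟩
    · obtain ⟨a', b', h⟩ := hx.1 a b
      obtain ⟨a'', b'', h'⟩ := hy.1 a' b'
      exact ⟨a'', b'', fun τ => by rw [mul_smul, h, h']⟩
    · obtain ⟨a', b', h⟩ := hy.2 a b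
      obtain ⟨a'', b'', h'⟩ := hx.2 a' b'
      exact ⟨a'', b'', fun τ => by rw [mul_inv_rev, mul_smul, h, h']⟩
  | inv x _ hx => exact ⟨hx.2, by simpa using hx.1⟩

lemma exists_thetaPow_smul {l : ℕ} (hl : l ≠ 0) (γ : SL(2, ℤ)) (a b : ℤ) :
    ∃ a' b' : ℤ, ∀ τ : ℍ, thetaPow l a b (γ • τ : ℍ) =
      ((γ 1 0 : ℂ) * τ + γ 1 1) ^ (12 * (2 * l) ^ 2) * thetaPow l a' b' τ := by
  obtain ⟨a', b', h⟩ := exists_thetaQuot_smul hl γ a b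
  refine ⟨a', b', fun τ => ?_⟩
  have h1 := h τ
  have hd := ModularForm.discriminant_ne_zero τ
  have hj := denom_SL_ne_zero γ τ
  rw [thetaQuot, thetaQuot, discriminant_smul, mul_pow, ← pow_mul] at h1
  field_simp at h1
  exact h1

/-- Hecke's reduction: integer matrices of determinant `m` have finitely many upper triangular
representatives modulo left multiplication by `SL(2, ℤ)`. -/
lemma exists_eq_mul_reps {m : ℤ} (hm : m ≠ 0) (A : FixedDetMatrix (Fin 2) ℤ m) :
    ∃ γ : SL(2, ℤ), ∃ B ∈ FixedDetMatrices.reps m, A = γ • B := by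
  induction A using FixedDetMatrices.induction_on hm with
  | h0 A h1 h2 h3 h4 => exact ⟨1, A, ⟨h1, h2, h3, h4⟩, (one_smul _ _).symm⟩
  | hS B h =>
    obtain ⟨γ, C, hC, rfl⟩ := h
    exact ⟨ModularGroup.S * γ, C, hC, (mul_smul _ _ _).symm⟩
  | hT B h =>
    obtain ⟨γ, C, hC, rfl⟩ := h
    exact ⟨ModularGroup.T * γ, C, hC, (mul_smul _ _ _).symm⟩

/-- The conjugates of `τ ↦ thetaPow l a b (N τ) / Δ(τ) ^ (2l)²` under the modular group. -/
def thetaConj (l : ℕ) {m : ℤ} (B : FixedDetMatrix (Fin 2) ℤ m) (a b : ℤ) (τ : ℍ) : ℂ :=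
  thetaPow l a b (((B.1 0 0 : ℂ) * τ + B.1 0 1) / B.1 1 1) /
    ((B.1 1 1 : ℂ) ^ (12 * (2 * l) ^ 2) * ModularForm.discriminant τ ^ (2 * l) ^ 2)

lemma reps_apply_one_one_pos {m : ℤ} (hm : 0 < m) {B : FixedDetMatrix (Fin 2) ℤ m}
    (hB : B ∈ FixedDetMatrices.reps m) : 0 < B.1 1 1 := by
  have h := B.2
  rw [Matrix.det_fin_two, hB.1, mul_zero, sub_zero] at h
  rw [← h] at hm
  exact pos_of_mul_pos_right hm hB.2.1.le

/-- Factor `diag(N, 1) γ = g B` with `B` upper triangular, so that `N · γτ = g(Bτ)`. The automorphy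
factor of `g` at `Bτ` is that of `γ` at `τ` divided by the lower right entry of `B`; it cancels
against `Δ` and leaves a constant. -/
lemma exists_thetaConj_eq {l N : ℕ} (hl : l ≠ 0) (hN : N ≠ 0) (a b : ℤ) (γ : SL(2, ℤ)) :
    ∃ B ∈ FixedDetMatrices.reps (N : ℤ), ∃ a' b' : ℤ, ∀ τ : ℍ,
      thetaPow l a b (N * (γ • τ : ℍ)) / ModularForm.discriminant (γ • τ) ^ (2 * l) ^ 2 =
        thetaConj l B a' b' τ := by
  have hNZ : (0 : ℤ) < N := by exact_mod_cast Nat.pos_of_ne_zero hN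
  have hγdet := γ.det_coe
  rw [Matrix.det_fin_two] at hγdet
  obtain ⟨g, B, hB, hgB⟩ := exists_eq_mul_reps hNZ.ne'
    (⟨!![N * γ 0 0, N * γ 0 1; γ 1 0, γ 1 1], by
      rw [Matrix.det_fin_two_of]; linear_combination (N : ℤ) * hγdet⟩ :
        FixedDetMatrix (Fin 2) ℤ (N : ℤ))
  obtain ⟨a', b', h⟩ := exists_thetaPow_smul hl g a b
  refine ⟨B, hB, a', b', fun τ => ?_⟩
  have hδ := reps_apply_one_one_pos hNZ hB
  have hα := hB.2.1
  have hB10 := hB.1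
  have hmat := congrArg Subtype.val hgB
  rw [FixedDetMatrices.smul_coe] at hmat
  have hent : ∀ i j, (!![(N : ℤ) * γ 0 0, N * γ 0 1; γ 1 0, γ 1 1] : Matrix (Fin 2) (Fin 2) ℤ) i j =
      g i 0 * B.1 0 j + g i 1 * B.1 1 j := fun i j => by
    have h1 := congrFun (congrFun hmat i) j
    rwa [Matrix.mul_apply, Fin.sum_univ_two] at h1
  have e00 := hent 0 0
  have e01 := hent 0 1
  have e10 := hent 1 0
  have e11 := hent 1 1
  simp only [Matrix.of_apply, Matrix.cons_val', Matrix.cons_val_zero, Matrix.cons_val_one,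
    hB10, mul_zero, add_zero] at e00 e01 e10 e11
  have hδC : (B.1 1 1 : ℂ) ≠ 0 := by exact_mod_cast hδ.ne'
  have hwim : 0 < (((B.1 0 0 : ℂ) * τ + B.1 0 1) / B.1 1 1).im := by
    have e : ((B.1 0 0 : ℂ) * τ + B.1 0 1) / B.1 1 1 =
      ((B.1 0 0 / B.1 1 1 : ℝ) : ℂ) * τ + ((B.1 0 1 / B.1 1 1 : ℝ) : ℂ) := by
      push_cast; field_simp
    rw [e]
    have hα' : (0 : ℝ) < B.1 0 0 := by exact_mod_cast hα
    have hδ' : (0 : ℝ) < B.1 1 1 := by exact_mod_cast hδ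
    have := τ.im_pos
    simp only [Complex.add_im, Complex.im_ofReal_mul, Complex.ofReal_im,
      add_zero]
    positivity
  obtain ⟨w, hw⟩ : ∃ w : ℍ, (w : ℂ) = ((B.1 0 0 : ℂ) * τ + B.1 0 1) / B.1 1 1 :=
    ⟨⟨_, hwim⟩, rfl⟩
  have hjw := denom_SL_ne_zero g w
  have hden : (γ 1 0 : ℂ) * τ + γ 1 1 = B.1 1 1 * ((g 1 0 : ℂ) * w + g 1 1) := by
    rw [hw, e10, e11]
    push_cast
    field_simp
    ring
  have hnum : (N : ℂ) * ((γ 0 0 : ℂ) * τ + γ 0 1) = B.1 1 1 * ((g 0 0 : ℂ) * w + g 0 1) := by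
    have h1 : (N : ℂ) * γ 0 0 = g 0 0 * B.1 0 0 := by exact_mod_cast e00
    have h2 : (N : ℂ) * γ 0 1 = g 0 0 * B.1 0 1 + g 0 1 * B.1 1 1 := by exact_mod_cast e01
    rw [hw]
    field_simp
    linear_combination (τ : ℂ) * h1 + h2
  have hpt : (N : ℂ) * (γ • τ : ℍ) = (g • w : ℍ) := by
    rw [coe_SL_smul, coe_SL_smul, ← mul_div_assoc, hnum, hden, mul_div_mul_left _ _ hδC]
  have hd := ModularForm.discriminant_ne_zero τ
  rw [hpt, h, discriminant_smul, hden, thetaConj, ← hw]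
  generalize (2 * l) ^ 2 = K
  rw [mul_pow, mul_pow, mul_pow, ← pow_mul, ← pow_mul]
  field_simp

/-! ### A criterion for modular functions -/

lemma finite_setOf_pow_eq {n : ℕ} (hn : 0 < n) (c : ℂ) : {z : ℂ | z ^ n = c}.Finite := by
  refine ((Polynomial.nthRoots n c).toFinset.finite_toSet).subset fun z hz => ?_
  simpa [Polynomial.mem_nthRoots hn] using hz

/-- The quotient `f / g` is continuous with values in the finite set of `n`-th roots of unity, hence
constant. -/
lemma eq_of_pow_eq_of_eq_at {X : Type*} [TopologicalSpace X] [PreconnectedSpace X] {n : ℕ}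
    (hn : 0 < n) {f g : X → ℂ} (hf : Continuous f) (hg : Continuous g) (hg0 : ∀ x, g x ≠ 0)
    (hpow : ∀ x, f x ^ n = g x ^ n) {x₀ : X} (h₀ : f x₀ = g x₀) : f = g := by
  have hc : Continuous fun x => f x / g x := hf.div hg hg0
  have hmaps : Set.MapsTo (fun x => f x / g x) Set.univ {z : ℂ | z ^ n = 1} := fun x _ => by
    simp only [Set.mem_ofPred_eq, div_pow, hpow]
    exact div_self (pow_ne_zero _ (hg0 x))
  funext x
  have h := isPreconnected_univ.eqOn_const_of_mapsTo
    (finite_setOf_pow_eq hn 1).isDiscrete hc.continuousOn hmaps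
  have h' : ∀ x, f x / g x = f x₀ / g x₀ := by
    rcases h ⟨1, by simp⟩ with ⟨z, -, hz⟩
    exact fun x => (hz (Set.mem_univ x)).trans (hz (Set.mem_univ x₀)).symm
  have := h' x
  rw [h₀, div_self (hg0 _), div_eq_one_iff_eq (hg0 x)] at this
  exact this

attribute [local instance] arrowAction in
/-- A function with finitely many conjugates up to roots of unity is invariant under a subgroup of
finite index. -/
lemma exists_finiteIndex_of_finite_pow {G X : Type*} [Group G] [MulAction G X] [TopologicalSpace X]
    [PreconnectedSpace X] (hsmul : ∀ γ : G, Continuous fun x : X => γ • x) {n : ℕ} (hn : 0 < n) {f : X → ℂ}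
    (hf : Continuous f) (hf0 : ∀ x, f x ≠ 0) (x₀ : X) {𝒮 : Set (X → ℂ)} (h𝒮 : 𝒮.Finite)
    (h : ∀ γ : G, (fun x => f (γ • x) ^ n) ∈ 𝒮) :
    ∃ Γ : Subgroup G, Γ.FiniteIndex ∧ ∀ γ ∈ Γ, ∀ x, f (γ • x) = f x := by
  refine ⟨MulAction.stabilizer G f, ?_, fun γ hγ x => ?_⟩
  · have horb : (MulAction.orbit G f).Finite := by
      have hT : (𝒮 ×ˢ ⋃ s ∈ 𝒮, {z : ℂ | z ^ n = s x₀}).Finite :=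
        h𝒮.prod (h𝒮.biUnion fun s _ => finite_setOf_pow_eq hn _)
      -- An element `k` of the orbit is determined by `k ^ n` and its value at `x₀`; the former lies
      -- in `𝒮` and the latter is one of finitely many roots.
      refine Set.Finite.of_finite_image (f := fun k : X → ℂ => ((fun x => k x ^ n), k x₀))
        (hT.subset ?_) ?_
      · rintro _ ⟨_, ⟨γ, rfl⟩, rfl⟩
        exact ⟨h γ⁻¹, Set.mem_biUnion (h γ⁻¹) rfl⟩
      · rintro _ ⟨γ, rfl⟩ _ ⟨γ', rfl⟩ hk
        simp only [Prod.mk.injEq] at hk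
        exact eq_of_pow_eq_of_eq_at hn (hf.comp (hsmul γ⁻¹))
          (hf.comp (hsmul γ'⁻¹)) (fun x => hf0 _) (fun x => congrFun hk.1 x) hk.2
    refine ⟨?_⟩
    rw [MulAction.index_stabilizer]
    exact ((Set.ncard_pos horb).2 ⟨f, MulAction.mem_orbit_self f⟩).ne'
  · have h1 : γ⁻¹ • f = f := inv_mem hγ
    have h2 := congrFun h1 x
    change f (γ⁻¹⁻¹ • x) = f x at h2
    rwa [inv_inv] at h2

lemma le_max_one_of_pow_le {x B : ℝ} {n : ℕ} (hn : n ≠ 0) (h : x ^ n ≤ B) : x ≤ max 1 B := by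
  rcases le_or_gt x 1 with h1 | h1
  · exact h1.trans (le_max_left _ _)
  · exact ((le_self_pow₀ h1.le hn).trans h).trans (le_max_right _ _)

lemma exists_norm_thetaPow_le (l : ℕ) (a b : ℤ) {c : ℝ} (hc : 0 < c) :
    ∃ B : ℝ, ∀ τ : ℂ, c ≤ τ.im → ‖thetaPow l a b τ‖ ≤ B := by
  obtain ⟨B, hB⟩ := norm_thetaChar_le (a / (2 * l)) (b / (2 * l)) hc
  refine ⟨B ^ (24 * (2 * l) ^ 2), fun τ hτ => ?_⟩
  rw [thetaPow, norm_pow]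
  have := hB τ hτ
  push_cast at this
  gcongr

/-- The theta part stays bounded high up in the half plane, and `1/Δ` grows at most like `exp(2π Im
τ)`. -/
lemma isBoundedAtImInfty_thetaConj {l : ℕ} {m : ℤ} (hm : 0 < m)
    {B : FixedDetMatrix (Fin 2) ℤ m} (hB : B ∈ FixedDetMatrices.reps m) (a b : ℤ) :
    ∃ C A : ℝ, ∀ τ : ℍ, A ≤ τ.im →
      ‖thetaConj l B a b τ‖ ≤ C * Real.exp (2 * Real.pi * τ.im) ^ (2 * l) ^ 2 := by
  have hδ : (0 : ℝ) < B.1 1 1 := by exact_mod_cast reps_apply_one_one_pos hm hB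
  have hα : (0 : ℝ) < B.1 0 0 := by exact_mod_cast hB.2.1
  obtain ⟨C₁, hC₁⟩ := exists_norm_thetaPow_le l a b (div_pos hα hδ)
  obtain ⟨C₂, hC₂⟩ := ModularForm.exp_isBigO_discriminant.bound
  obtain ⟨A, hA⟩ := UpperHalfPlane.atImInfty_mem _ |>.1 hC₂
  have hC₂0 : 0 ≤ max C₂ 0 := le_max_right _ _
  refine ⟨C₁ * ((B.1 1 1 : ℝ) ^ (12 * (2 * l) ^ 2))⁻¹ * (max C₂ 0) ^ (2 * l) ^ 2, max A 1,
    fun τ hτ => ?_⟩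
  have him : (B.1 0 0 : ℝ) / B.1 1 1 ≤ (((B.1 0 0 : ℂ) * τ + B.1 0 1) / B.1 1 1).im := by
    have hδ' : ((B.1 1 1 : ℝ) : ℂ) ≠ 0 := by exact_mod_cast hδ.ne'
    have e : ((B.1 0 0 : ℂ) * τ + B.1 0 1) / B.1 1 1 =
      ((B.1 0 0 / B.1 1 1 : ℝ) : ℂ) * τ + ((B.1 0 1 / B.1 1 1 : ℝ) : ℂ) := by
      push_cast at hδ' ⊢
      field_simp
    rw [e, Complex.add_im, Complex.im_ofReal_mul, Complex.ofReal_im, add_zero]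
    exact le_mul_of_one_le_right (by positivity) ((le_max_right _ _).trans hτ)
  have h1 := hC₁ _ him
  have h2 : ‖(ModularForm.discriminant τ)⁻¹‖ ≤ max C₂ 0 * Real.exp (2 * Real.pi * τ.im) := by
    have h3 := hA τ ((le_max_left _ _).trans hτ)
    simp only [Set.mem_ofPred_eq, Real.norm_eq_abs, Real.abs_exp] at h3
    have hd : 0 < ‖ModularForm.discriminant τ‖ := norm_pos_iff.2 (ModularForm.discriminant_ne_zero τ)
    have h4 : Real.exp (-2 * Real.pi * τ.im) * Real.exp (2 * Real.pi * τ.im) = 1 := by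
      rw [← Real.exp_add]; simp
    have h5 : Real.exp (-2 * Real.pi * τ.im) ≤ max C₂ 0 * ‖ModularForm.discriminant τ‖ :=
      h3.trans (by gcongr; exact le_max_left _ _)
    rw [norm_inv, inv_le_iff_one_le_mul₀ hd]
    calc 1 = Real.exp (-2 * Real.pi * τ.im) * Real.exp (2 * Real.pi * τ.im) := h4.symm
      _ ≤ (max C₂ 0 * ‖ModularForm.discriminant τ‖) * Real.exp (2 * Real.pi * τ.im) := by gcongr
      _ = _ := by ring
  have h0 : 0 ≤ C₁ := (norm_nonneg _).trans h1
  rw [thetaConj, div_eq_mul_inv, mul_inv, norm_mul, norm_mul, ← inv_pow (ModularForm.discriminant τ),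
    norm_pow (ModularForm.discriminant τ)⁻¹, norm_inv, norm_pow]
  have h3 : ‖(B.1 1 1 : ℂ)‖ = B.1 1 1 := by
    rw [Complex.norm_intCast, abs_of_pos hδ]
  rw [h3]
  calc _ ≤ C₁ * (((B.1 1 1 : ℝ) ^ (12 * (2 * l) ^ 2))⁻¹ *
        (max C₂ 0 * Real.exp (2 * Real.pi * τ.im)) ^ (2 * l) ^ 2) := by gcongr
    _ = _ := by rw [mul_pow]; ring

/-- A nowhere vanishing holomorphic function a power of which is a power of a theta function divided
by a power of `Δ` is a modular function. -/
theorem isModularFunction_of_pow_eq {l N : ℕ} (hl : l ≠ 0) (hN : N ≠ 0) (a b : ℤ) {f : ℍ → ℂ}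
    (hf : MDifferentiable 𝓘(ℂ) 𝓘(ℂ) f) (hf0 : ∀ τ, f τ ≠ 0)
    (hpow : ∀ τ : ℍ, f τ ^ (24 * (2 * l) ^ 2) =
      thetaPow l a b (N * τ) / ModularForm.discriminant τ ^ (2 * l) ^ 2) :
    IsModularFunction f := by
  have hK : (2 * l) ^ 2 ≠ 0 := by positivity
  have hn : 0 < 24 * (2 * l) ^ 2 := by positivity
  have hNZ : (0 : ℤ) < N := by exact_mod_cast Nat.pos_of_ne_zero hN
  -- The pole bound `1` suffices: each conjugate has `24 (2l)²`-th power of growth at most `exp(2π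
  -- Im τ) ^ (2l)²`, so it grows at most like `exp(2π Im τ / 24)`.
  refine ⟨hf, ?_, fun γ => ⟨1, ?_⟩⟩
  · set 𝒮 : Set (ℍ → ℂ) := ⋃ B ∈ FixedDetMatrices.reps (N : ℤ),
      Set.range fun p : ℤ × ℤ => thetaConj l B p.1 p.2 with h𝒮
    have hfin : 𝒮.Finite := by
      refine (Set.toFinite (FixedDetMatrices.reps (N : ℤ))).biUnion fun B _ =>
        finite_range_of_periodic (L := 2 * l) (by positivity) (fun b a => ?_) (fun a b => ?_)
      · funext τ
        simp only [thetaConj]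
        exact congrArg (· / _) (thetaPow_periodic_left hl b _ a)
      · funext τ
        simp only [thetaConj]
        exact congrArg (· / _) (thetaPow_periodic_right hl a _ b)
    have hsmul : ∀ γ : SL(2, ℤ), Continuous fun τ : ℍ => γ • τ := fun γ =>
      continuous_const_smul (γ : GL (Fin 2) ℝ)
    refine exists_finiteIndex_of_finite_pow hsmul hn hf.continuous hf0 UpperHalfPlane.I hfin fun γ => ?_
    obtain ⟨B, hB, a', b', h⟩ := exists_thetaConj_eq hl hN a b γ
    refine Set.mem_biUnion hB ⟨(a', b'), ?_⟩
    funext τ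
    rw [hpow, h]
  · obtain ⟨B, hB, a', b', h⟩ := exists_thetaConj_eq hl hN a b γ
    obtain ⟨C, A, hC⟩ := isBoundedAtImInfty_thetaConj (l := l) hNZ hB a' b'
    rw [UpperHalfPlane.isBoundedAtImInfty_iff]
    refine ⟨max 1 C, A, fun τ hτ => le_max_one_of_pow_le hn.ne' ?_⟩
    rw [norm_mul, mul_pow, ← norm_pow (f (γ • τ)), hpow, h]
    have h1 : ‖Complex.exp (2 * Real.pi * Complex.I * ((1 : ℕ) : ℂ) * (τ : ℂ))‖ =
        Real.exp (-(2 * Real.pi * τ.im)) := by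
      rw [Complex.norm_exp]
      congr 1
      rw [show 2 * Real.pi * Complex.I * ((1 : ℕ) : ℂ) * (τ : ℂ) =
        ((2 * Real.pi : ℝ) : ℂ) * (Complex.I * τ) by push_cast; ring, Complex.re_ofReal_mul]
      simp
    rw [h1]
    have hC' := hC τ hτ
    have hpos := τ.im_pos
    have hC0 : 0 ≤ C := by
      have := (norm_nonneg _).trans hC'
      exact nonneg_of_mul_nonneg_left this (by positivity)
    have h2 : Real.exp (-(2 * Real.pi * τ.im)) ^ (24 * (2 * l) ^ 2) ≤
        Real.exp (-(2 * Real.pi * τ.im)) ^ (2 * l) ^ 2 :=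
      pow_le_pow_of_le_one (Real.exp_pos _).le (Real.exp_le_one_iff.2 (by
        have := Real.pi_pos; nlinarith [mul_pos this hpos])) (by omega)
    calc _ ≤ Real.exp (-(2 * Real.pi * τ.im)) ^ (2 * l) ^ 2 *
          (C * Real.exp (2 * Real.pi * τ.im) ^ (2 * l) ^ 2) := by gcongr
      _ = C * (Real.exp (-(2 * Real.pi * τ.im)) * Real.exp (2 * Real.pi * τ.im)) ^ (2 * l) ^ 2 := by
        rw [mul_pow]; ring
      _ = C := by rw [← Real.exp_add]; simp

/-! ### Theta quotients -/

lemma cexp_two_pi_mul_lt_one {u : ℂ} (hu : 0 < u.im) :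
    ‖Complex.exp (2 * Real.pi * Complex.I * u)‖ < 1 := by
  rw [Complex.norm_exp, show 2 * Real.pi * Complex.I * u =
    ((2 * Real.pi : ℝ) : ℂ) * (Complex.I * u) by push_cast; ring, Complex.re_ofReal_mul]
  simp only [Complex.mul_re, Complex.I_re, zero_mul, Complex.I_im, one_mul, zero_sub, mul_neg,
    Real.exp_lt_one_iff, Left.neg_neg_iff]
  positivity

/-- The Jacobi triple product identity in terms of the two-variable theta function. -/
theorem jacobiTheta₂_eq_qPochInf₃ {u v : ℂ} (hu : 0 < u.im) (hv : 0 < v.im) {x y : ℂ}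
    (hx : x = Complex.exp (2 * Real.pi * Complex.I * u))
    (hy : y = Complex.exp (2 * Real.pi * Complex.I * v)) :
    jacobiTheta₂ (1 / 2 + (u - v) / 2) (u + v) = qPochInf₃ x y (x * y) (x * y) := by
  have h := hasSum_jacobiTerm (x := x) (y := y) (hx ▸ cexp_two_pi_mul_lt_one hu)
    (hy ▸ cexp_two_pi_mul_lt_one hv)
  have hterm : ∀ (a : ℕ) (z w : ℂ) , (-1) ^ a *
      ((Complex.exp (2 * Real.pi * Complex.I * z) * Complex.exp (2 * Real.pi * Complex.I * w)) ^
        a.choose 2 * Complex.exp (2 * Real.pi * Complex.I * z) ^ a) =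
      Complex.exp (Real.pi * Complex.I * (a + a * (z - w) + a ^ 2 * (z + w))) := by
    intro a z w
    rw [← Complex.exp_add, ← Complex.exp_nat_mul, ← Complex.exp_nat_mul, ← Complex.exp_pi_mul_I,
      ← Complex.exp_nat_mul, ← Complex.exp_add, ← Complex.exp_add, Nat.cast_choose_two]
    congr 1
    ring
  rw [← Equiv.intEquivNatSumNat.hasSum_iff] at h
  refine HasSum.tsum_eq (h.congr_fun fun n => ?_)
  rcases n with a | b
  · change jacobiTheta₂_term a _ _ = jacobiTerm x y (Sum.inl a)
    rw [jacobiTerm, Sum.elim_inl, hx, hy, hterm, jacobiTheta₂_term]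
    congr 1
    push_cast
    ring
  · change jacobiTheta₂_term (Int.negSucc b) _ _ = jacobiTerm x y (Sum.inr b)
    rw [jacobiTerm, Sum.elim_inr, mul_comm x y, hx, hy, hterm, jacobiTheta₂_term,
      Complex.exp_eq_exp_iff_exists_int]
    -- The signs `exp(πi n)` at `n = -(b + 1)` and at `n = b + 1` agree, their exponents differing
    -- by `-(b + 1) · 2πi`.
    refine ⟨-(b + 1), ?_⟩
    rw [Int.cast_negSucc]
    push_cast
    ring

lemma eta_eq_qPochInf (τ : ℂ) {q : ℂ} (hq : q = Complex.exp (2 * Real.pi * Complex.I * τ)) :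
    ModularForm.eta τ = Complex.exp (2 * Real.pi * Complex.I * τ / 24) * qPochInf q q := by
  rw [ModularForm.eta, qPochInf, Function.Periodic.qParam]
  congr 1
  refine tprod_congr fun n => ?_
  rw [ModularForm.eta_q_eq_pow, ← hq, pow_succ']

/-- A nowhere vanishing theta function with rational characteristics, rescaled and divided by the
Dedekind eta function, is a modular function. -/
theorem isModularFunction_thetaChar_div_eta {l N : ℕ} (hl : l ≠ 0) (hN : N ≠ 0) (a b : ℤ)
    (h0 : ∀ τ : ℍ, thetaChar ((a : ℂ) / (2 * l)) ((b : ℂ) / (2 * l)) (N * τ) ≠ 0) :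
    IsModularFunction fun τ : ℍ =>
      thetaChar ((a : ℂ) / (2 * l)) ((b : ℂ) / (2 * l)) (N * τ) / ModularForm.eta τ := by
  have hη : ∀ τ : ℍ, ModularForm.eta τ ≠ 0 := fun τ => ModularForm.eta_ne_zero τ.2
  refine isModularFunction_of_pow_eq hl hN a b ?_ (fun τ => div_ne_zero (h0 τ) (hη τ))
    fun τ => ?_
  · rw [UpperHalfPlane.mdifferentiable_iff]
    set r : ℂ := (a : ℂ) / (2 * l)
    set s : ℂ := (b : ℂ) / (2 * l)
    have hd : DifferentiableOn ℂ (fun z : ℂ => thetaChar r s (N * z) / ModularForm.eta z)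
        {z | 0 < z.im} := by
      intro z hz
      have hz' : 0 < ((N : ℂ) * z).im := by
        have : (0 : ℝ) < N := by exact_mod_cast Nat.pos_of_ne_zero hN
        have hz0 : 0 < z.im := hz
        rw [← Complex.ofReal_natCast, Complex.im_ofReal_mul]
        positivity
      have h1 : DifferentiableAt ℂ (fun z : ℂ => jacobiTheta₂ (r * (N * z) + s) (N * z)) z :=
        (hasFDerivAt_jacobiTheta₂ (r * (N * z) + s) hz').differentiableAt.comp z
          (f := fun z : ℂ => (r * (N * z) + s, (N : ℂ) * z)) (by fun_prop)
      have h2 : DifferentiableAt ℂ (fun z : ℂ => thetaChar r s (N * z)) z := by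
        unfold thetaChar
        exact DifferentiableAt.mul (by fun_prop) h1
      exact (h2.div (ModularForm.differentiableAt_eta_of_mem_upperHalfPlaneSet hz)
        (ModularForm.eta_ne_zero hz)).differentiableWithinAt
    refine hd.congr fun z hz => ?_
    simp [UpperHalfPlane.ofComplex_apply_of_im_pos hz]
  · rw [div_pow, ModularForm.discriminant, ← pow_mul]
    rfl

/-! ### Generalized Nahm sums of index `(1, 1, 2)` -/

/-- Functions on a set with three elements as triples. -/
def finThreeArrowEquivProd : (Fin 3 → ℕ) ≃ ℕ × ℕ × ℕ where
  toFun n := (n 0, n 1, n 2)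
  invFun p := ![p.1, p.2.1, p.2.2]
  left_inv n := by
    ext i
    fin_cases i <;> rfl
  right_inv _ := rfl

lemma nahmSum_eq_of_hasSum {A : Matrix (Fin 3) (Fin 3) ℚ} {b : Fin 3 → ℚ} {c : ℚ}
    {N : ℕ → ℕ → ℕ → ℕ} (hE : ∀ n, nahmExponent A b c ![1, 1, 2] n = N (n 0) (n 1) (n 2) + c)
    {τ : ℍ} {q P : ℂ} (hq : q = Complex.exp (2 * Real.pi * Complex.I * τ))
    (h : HasSum (index112Term q N) P) :
    nahmSum A b c ![1, 1, 2] τ = Complex.exp (2 * Real.pi * Complex.I * c * τ) * P := by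
  have h1 := (finThreeArrowEquivProd.hasSum_iff.2 h).mul_left
    (Complex.exp (2 * Real.pi * Complex.I * c * τ))
  refine HasSum.tsum_eq (h1.congr_fun fun n => ?_)
  have e1 : Complex.exp (2 * Real.pi * Complex.I * ((1 : ℕ) : ℂ) * τ) = q := by
    rw [hq]; simp
  have e2 : Complex.exp (2 * Real.pi * Complex.I * ((2 : ℕ) : ℂ) * τ) = q ^ 2 := by
    rw [hq, ← Complex.exp_nat_mul]; congr 1; push_cast; ring
  have e3 : Complex.exp (2 * Real.pi * Complex.I *
      (nahmExponent A b c ![1, 1, 2] n : ℂ) * (τ : ℂ)) =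
      Complex.exp (2 * Real.pi * Complex.I * c * τ) * q ^ N (n 0) (n 1) (n 2) := by
    rw [hE, hq, ← Complex.exp_nat_mul, ← Complex.exp_add]
    congr 1
    push_cast
    ring
  rw [Fin.prod_univ_three]
  simp only [Matrix.cons_val_zero, Matrix.cons_val_one, Matrix.cons_val, e1, e2, e3,
    Function.comp_apply, index112Term]
  rw [mul_div_assoc]
  rfl

/-- The modularity of a Nahm sum given by the product side of a Rogers–Ramanujan type identity. -/
theorem isModularFunction_nahmSum {A : Matrix (Fin 3) (Fin 3) ℚ} {b : Fin 3 → ℚ} {c : ℚ}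
    {E : ℕ → ℕ → ℕ → ℕ} (m u v : ℕ) (hm : m ≠ 0) (hu : u ≠ 0) (hv : v ≠ 0) (huv : u + v = 5)
    (hE : ∀ n, nahmExponent A b c ![1, 1, 2] n = E (n 0) (n 1) (n 2) + c)
    (hc : c + 1 / 24 = m * (u - v) ^ 2 / 40)
    (h : ∀ q : ℂ, ‖q‖ < 1 → HasSum (index112Term q E)
      (qPochInf₃ (q ^ (m * u)) (q ^ (m * v)) (q ^ (m * 5)) (q ^ (m * 5)) / qPochInf q q)) :
    IsModularFunction (nahmSum A b c ![1, 1, 2]) := by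
  have hc' : (c : ℂ) + 1 / 24 = m * (u - v) ^ 2 / 40 := by
    have h1 := congrArg (fun x : ℚ => (x : ℂ)) hc
    push_cast at h1
    exact h1
  have huv' : (u : ℂ) + v = 5 := by exact_mod_cast huv
  -- The triple product with `x = q^{mu}`, `y = q^{mv}` is a theta function at `5mτ` with
  -- characteristics `(u - v)/10` and `1/2`, whence `l = 5`. Its prefactor is `q^{m(u-v)²/40}`, and
  -- `η` contributes the `1/24`; this is the condition `hc`.
  have key : ∀ τ : ℍ, ∀ q : ℂ, q = Complex.exp (2 * Real.pi * Complex.I * τ) →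
      thetaChar ((((u : ℤ) - v : ℤ) : ℂ) / (2 * (5 : ℕ))) (((5 : ℤ) : ℂ) / (2 * (5 : ℕ)))
        ((5 * m : ℕ) * τ) = Complex.exp (2 * Real.pi * Complex.I * (c + 1 / 24) * τ) *
          qPochInf₃ (q ^ (m * u)) (q ^ (m * v)) (q ^ (m * 5)) (q ^ (m * 5)) := by
    intro τ q hq
    have him : ∀ k : ℕ, k ≠ 0 → 0 < (((m * k : ℕ) : ℂ) * τ).im := fun k hk => by
      rw [← Complex.ofReal_natCast, Complex.im_ofReal_mul]
      have : (0 : ℝ) < (m * k : ℕ) := by exact_mod_cast Nat.pos_of_ne_zero (mul_ne_zero hm hk)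
      have := τ.im_pos
      positivity
    have hpow : ∀ k : ℕ, q ^ (m * k) =
        Complex.exp (2 * Real.pi * Complex.I * (((m * k : ℕ) : ℂ) * τ)) := fun k => by
      rw [hq, ← Complex.exp_nat_mul]
      congr 1
      ring
    have h1 := jacobiTheta₂_eq_qPochInf₃ (him u hu) (him v hv) (hpow u) (hpow v)
    rw [← pow_add, ← mul_add, huv] at h1
    rw [← h1, thetaChar]
    congr 1
    · congr 1
      rw [hc']
      push_cast
      ring
    · congr 1
      · push_cast
        ring
      · push_cast
        linear_combination (-(m : ℂ) * τ) * huv'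
  have hlt : ∀ τ : ℍ, ‖Complex.exp (2 * Real.pi * Complex.I * (τ : ℂ))‖ < 1 := fun τ =>
    cexp_two_pi_mul_lt_one τ.im_pos
  have hf : nahmSum A b c ![1, 1, 2] = fun τ : ℍ =>
      thetaChar ((((u : ℤ) - v : ℤ) : ℂ) / (2 * (5 : ℕ))) (((5 : ℤ) : ℂ) / (2 * (5 : ℕ)))
        ((5 * m : ℕ) * τ) / ModularForm.eta τ := by
    funext τ
    rw [nahmSum_eq_of_hasSum hE rfl (h _ (hlt τ)), key τ _ rfl, eta_eq_qPochInf _ rfl,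
      mul_div_mul_comm, ← Complex.exp_sub]
    congr 2
    ring
  rw [hf]
  refine isModularFunction_thetaChar_div_eta (by norm_num) (by positivity) _ _ fun τ => ?_
  rw [key τ _ rfl]
  have hk : ∀ k : ℕ, k ≠ 0 → ‖Complex.exp (2 * Real.pi * Complex.I * (τ : ℂ)) ^ (m * k)‖ < 1 :=
    fun k hk => by
      rw [norm_pow]
      exact pow_lt_one₀ (norm_nonneg _) (hlt τ) (mul_ne_zero hm hk)
  exact mul_ne_zero (Complex.exp_ne_zero _) (mul_ne_zero (mul_ne_zero
    (qPochInf_ne_zero (hk u hu) (hk 5 (by norm_num)))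
    (qPochInf_ne_zero (hk v hv) (hk 5 (by norm_num))))
    (qPochInf_ne_zero (hk 5 (by norm_num)) (hk 5 (by norm_num))))

/-! ### Positive definiteness

The suffix of a lemma lists the entries of the matrix row by row. -/

/-- Triangular completion of squares with positive pivots: if the form vanishes, the coordinates
vanish successively from the last to the first. -/
lemma posDef_of_sum_sq {M : Matrix (Fin 3) (Fin 3) ℝ} (hM : M.IsHermitian) {p r s α β γ : ℝ}
    (hp : 0 < p) (hr : 0 < r) (hs : 0 < s)
    (h : ∀ v : Fin 3 → ℝ, v ⬝ᵥ Matrix.mulVec M v =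
      p * (v 0 + α * v 1 + β * v 2) ^ 2 + r * (v 1 + γ * v 2) ^ 2 + s * v 2 ^ 2) : M.PosDef := by
  refine Matrix.PosDef.of_dotProduct_mulVec_pos hM fun v hv => ?_
  rw [star_trivial, h]
  by_contra hneg
  have h1 : 0 ≤ p * (v 0 + α * v 1 + β * v 2) ^ 2 := by positivity
  have h2 : 0 ≤ r * (v 1 + γ * v 2) ^ 2 := by positivity
  have h3 : 0 ≤ s * v 2 ^ 2 := by positivity
  have e2 : v 2 = 0 := by
    have : s * v 2 ^ 2 = 0 := by linarith
    simpa [hs.ne'] using this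
  have e1 : v 1 = 0 := by
    have : r * (v 1 + γ * v 2) ^ 2 = 0 := by linarith
    simpa [hr.ne', e2] using this
  have e0 : v 0 = 0 := by
    have : p * (v 0 + α * v 1 + β * v 2) ^ 2 = 0 := by linarith
    simpa [hp.ne', e2, e1] using this
  apply hv
  ext i
  fin_cases i
  · exact e0
  · exact e1
  · exact e2

/-! ### The main theorem -/

section

variable {q : ℂ} {m : ℕ}

lemma hasSum_rogersRamanujan_pow (hq : ‖q‖ < 1) (hm : m ≠ 0) :
    HasSum (fun s : ℕ => (q ^ m) ^ (s ^ 2 + 0 * s) / qPoch (q ^ m) (q ^ m) s)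
      (qPochInf₃ (q ^ (m * 2)) (q ^ (m * 3)) (q ^ (m * 5)) (q ^ (m * 5)) /
        qPochInf (q ^ m) (q ^ m)) := by
  have hp : ‖q ^ m‖ < 1 := by rw [norm_pow]; exact pow_lt_one₀ (norm_nonneg _) hq hm
  simpa only [zero_mul, add_zero, pow_mul] using hasSum_rogersRamanujan hp

lemma hasSum_rogersRamanujan_odd_pow (hq : ‖q‖ < 1) (hm : m ≠ 0) :
    HasSum (fun s : ℕ => (q ^ m) ^ (s ^ 2 + 1 * s) / qPoch (q ^ m) (q ^ m) s)
      (qPochInf₃ (q ^ (m * 1)) (q ^ (m * 4)) (q ^ (m * 5)) (q ^ (m * 5)) /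
        qPochInf (q ^ m) (q ^ m)) := by
  have hp : ‖q ^ m‖ < 1 := by rw [norm_pow]; exact pow_lt_one₀ (norm_nonneg _) hq hm
  simpa only [one_mul, mul_one, pow_mul] using hasSum_rogersRamanujan_odd hp

end

lemma mul_diagonal_one_one_two (a b c d e f g h i : ℚ) :
    !![a, b, c; d, e, f; g, h, i] *
      Matrix.diagonal (fun i => ((![1, 1, 2] : Fin 3 → ℕ) i : ℚ)) =
    !![a, b, c * 2; d, e, f * 2; g, h, i * 2] := by
  ext j k
  rw [Matrix.mul_diagonal]
  fin_cases j <;> fin_cases k <;> simp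

lemma posDef_110_121_024 : (((!![1, 1, 0; 1, 2, 1; 0, 2, 4] : Matrix (Fin 3) (Fin 3) ℚ) *
    Matrix.diagonal (fun i => ((![1, 1, 2] : Fin 3 → ℕ) i : ℚ))).map
      (fun x : ℚ => (x : ℝ))).PosDef := by
  rw [mul_diagonal_one_one_two]
  refine posDef_of_sum_sq (p := 1) (r := 1) (s := 4) (α := 1) (β := 0) (γ := 2) ?_
    (by norm_num) (by norm_num) (by norm_num) fun v => ?_
  · ext i j
    fin_cases i <;> fin_cases j <;> norm_num
  · simp [Matrix.mulVec, dotProduct, Fin.sum_univ_three]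
    ring

lemma posDef_110_181_021 : (((!![1, 1, 0; 1, 8, 1; 0, 2, 1] : Matrix (Fin 3) (Fin 3) ℚ) *
    Matrix.diagonal (fun i => ((![1, 1, 2] : Fin 3 → ℕ) i : ℚ))).map
      (fun x : ℚ => (x : ℝ))).PosDef := by
  rw [mul_diagonal_one_one_two]
  refine posDef_of_sum_sq (p := 1) (r := 7) (s := 10 / 7) (α := 1) (β := 0) (γ := 2 / 7) ?_
    (by norm_num) (by norm_num) (by norm_num) fun v => ?_
  · ext i j
    fin_cases i <;> fin_cases j <;> norm_num
  · simp [Matrix.mulVec, dotProduct, Fin.sum_univ_three]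
    ring

lemma posDef_111_154_288 : (((!![1, 1, 1; 1, 5, 4; 2, 8, 8] : Matrix (Fin 3) (Fin 3) ℚ) *
    Matrix.diagonal (fun i => ((![1, 1, 2] : Fin 3 → ℕ) i : ℚ))).map
      (fun x : ℚ => (x : ℝ))).PosDef := by
  rw [mul_diagonal_one_one_two]
  refine posDef_of_sum_sq (p := 1) (r := 4) (s := 3) (α := 1) (β := 2) (γ := 3 / 2) ?_
    (by norm_num) (by norm_num) (by norm_num) fun v => ?_
  · ext i j
    fin_cases i <;> fin_cases j <;> norm_num
  · simp [Matrix.mulVec, dotProduct, Fin.sum_univ_three]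
    ring

lemma posDef_211_141_222 : (((!![2, 1, 1; 1, 4, 1; 2, 2, 2] : Matrix (Fin 3) (Fin 3) ℚ) *
    Matrix.diagonal (fun i => ((![1, 1, 2] : Fin 3 → ℕ) i : ℚ))).map
      (fun x : ℚ => (x : ℝ))).PosDef := by
  rw [mul_diagonal_one_one_two]
  refine posDef_of_sum_sq (p := 2) (r := 7 / 2) (s := 12 / 7) (α := 1 / 2) (β := 1) (γ := 2 / 7) ?_
    (by norm_num) (by norm_num) (by norm_num) fun v => ?_
  · ext i j
    fin_cases i <;> fin_cases j <;> norm_num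
  · simp [Matrix.mulVec, dotProduct, Fin.sum_univ_three]
    ring

/-- A Nahm sum of index `(1, 1, 2)` with a Rogers–Ramanujan product gives a modular quadruple. -/
lemma exists_isModularQuadruple {A : Matrix (Fin 3) (Fin 3) ℚ} {b : Fin 3 → ℚ}
    {E : ℕ → ℕ → ℕ → ℕ} (m u v : ℕ) (hm : m ≠ 0) (hu : u ≠ 0) (hv : v ≠ 0) (huv : u + v = 5)
    (hA : ((A * Matrix.diagonal (fun i => ((![1, 1, 2] : Fin 3 → ℕ) i : ℚ))).map
      (fun x : ℚ => (x : ℝ))).PosDef)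
    (hE : ∀ (c : ℚ) n, nahmExponent A b c ![1, 1, 2] n = E (n 0) (n 1) (n 2) + c)
    (h : ∀ q : ℂ, ‖q‖ < 1 → HasSum (index112Term q E)
      (qPochInf₃ (q ^ (m * u)) (q ^ (m * v)) (q ^ (m * 5)) (q ^ (m * 5)) / qPochInf q q)) :
    ∃ c : ℚ, IsModularQuadruple A b c ![1, 1, 2] :=
  ⟨m * (u - v) ^ 2 / 40 - 1 / 24, fun i => by fin_cases i <;> simp, hA,
    isModularFunction_nahmSum m u v hm hu hv huv (hE _) (by ring) h⟩

end

theorem mainTheorem9 :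
    (∀ q : ℂ, ‖q‖ < 1 →
      HasIndex112Sum q (fun i j k =>
          1 / 2 * i ^ 2 + j ^ 2 + 4 * k ^ 2 + i * j + 2 * j * k + 1 / 2 * i + j)
        (qPochInf₃ (q ^ 8) (q ^ 12) (q ^ 20) (q ^ 20) / qPochInf q q) ∧
      HasIndex112Sum q (fun i j k =>
          1 / 2 * i ^ 2 + j ^ 2 + 4 * k ^ 2 + i * j + 2 * j * k + 1 / 2 * i + j + 4 * k)
        (qPochInf₃ (q ^ 4) (q ^ 16) (q ^ 20) (q ^ 20) / qPochInf q q) ∧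
      HasIndex112Sum q (fun i j k =>
          1 / 2 * i ^ 2 + 5 / 2 * j ^ 2 + 8 * k ^ 2 + i * j + 2 * i * k + 8 * j * k + 1 / 2 * i - 1 / 2 * j)
        (qPochInf₃ (q ^ 4) (q ^ 6) (q ^ 10) (q ^ 10) / qPochInf q q) ∧
      HasIndex112Sum q (fun i j k =>
          1 / 2 * i ^ 2 + 5 / 2 * j ^ 2 + 8 * k ^ 2 + i * j + 2 * i * k + 8 * j * k + 1 / 2 * i + 3 / 2 * j + 4 * k)
        (qPochInf₃ (q ^ 2) (q ^ 8) (q ^ 10) (q ^ 10) / qPochInf q q) ∧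
      HasIndex112Sum q (fun i j k =>
          1 / 2 * i ^ 2 + 4 * j ^ 2 + k ^ 2 + i * j + 2 * j * k + 1 / 2 * i + k)
        (qPochInf₃ (q ^ 8) (q ^ 12) (q ^ 20) (q ^ 20) / qPochInf q q) ∧
      HasIndex112Sum q (fun i j k =>
          1 / 2 * i ^ 2 + 4 * j ^ 2 + k ^ 2 + i * j + 2 * j * k + 1 / 2 * i + 4 * j + k)
        (qPochInf₃ (q ^ 4) (q ^ 16) (q ^ 20) (q ^ 20) / qPochInf q q) ∧
      HasIndex112Sum q (fun i j k =>
          i ^ 2 + 2 * j ^ 2 + 2 * k ^ 2 + i * j + 2 * i * k + 2 * j * k + k)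
        (qPochInf₃ (q ^ 4) (q ^ 6) (q ^ 10) (q ^ 10) / qPochInf q q) ∧
      HasIndex112Sum q (fun i j k =>
          i ^ 2 + 2 * j ^ 2 + 2 * k ^ 2 + i * j + 2 * i * k + 2 * j * k + 2 * j + k)
        (qPochInf₃ (q ^ 2) (q ^ 8) (q ^ 10) (q ^ 10) / qPochInf q q)) ∧
    (∃ c : ℚ, IsModularQuadruple !![1, 1, 0; 1, 2, 1; 0, 2, 4] ![1 / 2, 1, 0] c ![1, 1, 2]) ∧
    (∃ c : ℚ, IsModularQuadruple !![1, 1, 0; 1, 2, 1; 0, 2, 4] ![1 / 2, 1, 4] c ![1, 1, 2]) ∧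
    (∃ c : ℚ, IsModularQuadruple !![1, 1, 1; 1, 5, 4; 2, 8, 8] ![1 / 2, -1 / 2, 0] c ![1, 1, 2]) ∧
    (∃ c : ℚ, IsModularQuadruple !![1, 1, 1; 1, 5, 4; 2, 8, 8] ![1 / 2, 3 / 2, 4] c ![1, 1, 2]) ∧
    (∃ c : ℚ, IsModularQuadruple !![1, 1, 0; 1, 8, 1; 0, 2, 1] ![1 / 2, 0, 1] c ![1, 1, 2]) ∧
    (∃ c : ℚ, IsModularQuadruple !![1, 1, 0; 1, 8, 1; 0, 2, 1] ![1 / 2, 4, 1] c ![1, 1, 2]) ∧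
    (∃ c : ℚ, IsModularQuadruple !![2, 1, 1; 1, 4, 1; 2, 2, 2] ![0, 0, 1] c ![1, 1, 2]) ∧
    (∃ c : ℚ, IsModularQuadruple !![2, 1, 1; 1, 4, 1; 2, 2, 2] ![0, 2, 1] c ![1, 1, 2]) := by
  -- The base of the Rogers–Ramanujan sum is `q⁴` where Euler's identity is used twice and `q²`
  -- where it is used once.
  have h4 : (4 : ℕ) ≠ 0 := by norm_num
  have h2 : (2 : ℕ) ≠ 0 := by norm_num
  have a0 := fun (q : ℂ) (hq : ‖q‖ < 1) =>
    hasSum_index112_110_121_024 hq (hasSum_rogersRamanujan_pow hq h4)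
  have a1 := fun (q : ℂ) (hq : ‖q‖ < 1) =>
    hasSum_index112_110_121_024 hq (hasSum_rogersRamanujan_odd_pow hq h4)
  have b0 := fun (q : ℂ) (hq : ‖q‖ < 1) =>
    hasSum_index112_110_181_021 hq (hasSum_rogersRamanujan_pow hq h4)
  have b1 := fun (q : ℂ) (hq : ‖q‖ < 1) =>
    hasSum_index112_110_181_021 hq (hasSum_rogersRamanujan_odd_pow hq h4)
  have c0 := fun (q : ℂ) (hq : ‖q‖ < 1) =>
    hasSum_index112_111_154_288 hq (hasSum_rogersRamanujan_pow hq h2)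
  have c1 := fun (q : ℂ) (hq : ‖q‖ < 1) =>
    hasSum_index112_111_154_288 hq (hasSum_rogersRamanujan_odd_pow hq h2)
  have d0 := fun (q : ℂ) (hq : ‖q‖ < 1) =>
    hasSum_index112_211_141_222 hq (hasSum_rogersRamanujan_pow hq h2)
  have d1 := fun (q : ℂ) (hq : ‖q‖ < 1) =>
    hasSum_index112_211_141_222 hq (hasSum_rogersRamanujan_odd_pow hq h2)
  refine ⟨fun q hq => ⟨hasIndex112Sum_of_natCast (a0 q hq) fun i j k => ?_,
    hasIndex112Sum_of_natCast (a1 q hq) fun i j k => ?_,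
    hasIndex112Sum_of_natCast (c0 q hq) fun i j k => ?_,
    hasIndex112Sum_of_natCast (c1 q hq) fun i j k => ?_,
    hasIndex112Sum_of_natCast (b0 q hq) fun i j k => ?_,
    hasIndex112Sum_of_natCast (b1 q hq) fun i j k => ?_,
    hasIndex112Sum_of_natCast (d0 q hq) fun i j k => ?_,
    hasIndex112Sum_of_natCast (d1 q hq) fun i j k => ?_⟩,
    exists_isModularQuadruple 4 2 3 h4 (by simp) (by simp) rfl posDef_110_121_024 (fun c n => ?_) a0,
    exists_isModularQuadruple 4 1 4 h4 (by simp) (by simp) rfl posDef_110_121_024 (fun c n => ?_) a1,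
    exists_isModularQuadruple 2 2 3 h2 (by simp) (by simp) rfl posDef_111_154_288 (fun c n => ?_) c0,
    exists_isModularQuadruple 2 1 4 h2 (by simp) (by simp) rfl posDef_111_154_288 (fun c n => ?_) c1,
    exists_isModularQuadruple 4 2 3 h4 (by simp) (by simp) rfl posDef_110_181_021 (fun c n => ?_) b0,
    exists_isModularQuadruple 4 1 4 h4 (by simp) (by simp) rfl posDef_110_181_021 (fun c n => ?_) b1,
    exists_isModularQuadruple 2 2 3 h2 (by simp) (by simp) rfl posDef_211_141_222 (fun c n => ?_) d0,
    exists_isModularQuadruple 2 1 4 h2 (by simp) (by simp) rfl posDef_211_141_222 (fun c n => ?_) d1⟩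
  iterate 8
    · push_cast [Nat.cast_choose_two]
      ring
  all_goals
    rw [nahmExponent, mul_diagonal_one_one_two]
    simp [Matrix.mulVec, dotProduct, Fin.sum_univ_three, Nat.cast_choose_two]
    ring
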